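/- Identify the hyperplane $\mathbb W=\{x_1=0\}$ of the first Heisenberg group with $\mathbb R^2$, with points $A=(z,t)$, let $\omega\subseteq\mathbb R^2$ be open, and let $\phi:\omega\to\mathbb R$. Suppose that - either $\phi$ is intrinsic Lipschitz continuous in $\omega$, that is, there is $L>0$ with $|\phi(A)-\phi(B)|\le L\,d_\phi(A,B)$ for all $A,B\in\omega$, where for $A=(z,t)$, $B=(z',t')$ $$d_\phi(A,B)=|z'-z|+\bigl|t'-t-\tfrac12(\phi(A)+\phi(B))(z'-z)\bigr|^{1/2};$$ - or $\phi$ is a continuous distributional solution of the balance law $\phi_z+[\phi^2/2]_t=w$ in $\omega$ for some $w\in L^\infty(\omega)$, that is, $\phi$ is continuous and $\int_\omega\bigl(\phi\,\partial_z f+\tfrac12\phi^2\,\partial_t f\bigr)\,d\mathcal L^2=-\int_\omega w f\,d\mathcal L^2$ for all $f\in C^\infty_c(\omega)$. Then $\phi$ is a Lagrangian solution of $W^\phi\phi=w$ in $\omega$, where $W^\phi\phi=\partial_z\phi+\tfrac12\partial_t(\phi^2)$. That is, $\phi$ is continuous, and there are an open set $\tilde\omega\subseteq\mathbb R^2$,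 a Borel function $\chi:\tilde\omega\to\mathbb R$ and a universally measurable function $\bar w:\omega\to\mathbb R$ such that, with $\Upsilon(s,\tau)=(s,\chi(s,\tau))$ and with sections $\tilde\omega_s=\{\tau:(s,\tau)\in\tilde\omega\}$ and $\omega_s=\{t:(s,t)\in\omega\}$: 1. $(\tilde\omega,\chi)$ is a full Lagrangian parameterisation: $\Upsilon(\tilde\omega)\subseteq\omega$; for every $s$ the map $\tau\mapsto\chi(s,\tau)$ is nondecreasing on $\tilde\omega_s$ and maps it onto $\omega_s$; and for every $\tau$ and every bounded open interval $(s_1,s_2)$ with $(s_1,s_2)\times\{\tau\}\subseteq\tilde\omega$, the map $s\mapsto\Upsilon(s,\tau)$ is absolutely continuous on $(s_1,s_2)$ and $\partial_s\chi(s,\tau)=\phi(\Upsilon(s,\tau))$ for a.e. $s\in(s_1,s_2)$; 2. for all such $\tau$ and $(s_1,s_2)$, the function $s\mapsto\phi(\Upsilon(s,\tau))$ is absolutely continuous on $(s_1,s_2)$ and $\frac{d}{ds}\phi(\Upsilon(s,\tau))=\bar w(\Upsilon(s,\tau))$ for a.e. $s\in(s_1,s_2)$; 3. if $A\in\omega$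 and $\alpha\in\mathbb R$ are such that for every integral curve $\Gamma:(-\delta,\delta)\to\omega$ of the vector field $\partial_z+\phi\,\partial_t$ with $\Gamma(0)=A$ the function $\phi\circ\Gamma$ has derivative $\alpha$ at $0$, then $\bar w(A)=\alpha$. -/

import Mathlib

open MeasureTheory Set

noncomputable section

namespace BalanceLaw

/-! The hyperplane `W = {x₁ = 0}` of the first Heisenberg group is identified with `ℝ × ℝ`, with
points `A = (z, t)`. Functions `φ : ω → ℝ` on an open set `ω ⊆ W` are represented by functions on
`ℝ × ℝ`; every notion below only looks at the values of `φ` on `ω`. -/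

/-- The graph quasidistance `d_φ` in the coordinates `(z, t)`. It is `‖(0, y, 0)‖ + ‖(0, 0, s)‖`
for the homogeneous norm `max (|x|) (|t|^(1/2))`, where `(x, y, s) = Φ(A)⁻¹ · Φ(B)` in the
Heisenberg group and `Φ(z, t) = (φ(z, t), z, t - z φ(z, t) / 2)` is the graph map. -/
def graphDist (φ : ℝ × ℝ → ℝ) (A B : ℝ × ℝ) : ℝ :=
  |B.1 - A.1| + Real.sqrt |B.2 - A.2 - (1 / 2) * (φ A + φ B) * (B.1 - A.1)|

/-- `φ` is an intrinsic Lipschitz continuous function in `ω`. -/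
def IsIntrinsicLipschitz (ω : Set (ℝ × ℝ)) (φ : ℝ × ℝ → ℝ) : Prop :=
  ∃ L : ℝ, 0 < L ∧ ∀ A ∈ ω, ∀ B ∈ ω, |φ A - φ B| ≤ L * graphDist φ A B

/-- `φ` is a continuous distributional solution in `ω` of the balance law
`∂_z φ + ∂_t (φ² / 2) = w`. -/
structure IsDistributionalSolution (ω : Set (ℝ × ℝ)) (φ w : ℝ × ℝ → ℝ) : Prop where
  continuousOn : ContinuousOn φ ω
  integral_eq : ∀ f : ℝ × ℝ → ℝ, ContDiff ℝ (⊤ : ℕ∞) f → HasCompactSupport f → tsupport f ⊆ ω →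
    ∫ p in ω, (φ p * fderiv ℝ f p (1, 0) + (1 / 2) * φ p ^ 2 * fderiv ℝ f p (0, 1)) =
      -∫ p in ω, w p * f p

/-- Absolute continuity (in the usual `ε`-`δ` sense) of a function on an interval `I`. -/
def AbsolutelyContinuousOn {X : Type*} [PseudoMetricSpace X] (f : ℝ → X) (I : Set ℝ) : Prop :=
  ∀ ε : ℝ, 0 < ε → ∃ δ : ℝ, 0 < δ ∧ ∀ (n : ℕ) (a b : Fin n → ℝ),
    (∀ i, a i ≤ b i ∧ a i ∈ I ∧ b i ∈ I) →
    (∀ i j, i ≠ j → Disjoint (Ioo (a i) (b i)) (Ioo (a j) (b j))) →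
    ∑ i, (b i - a i) < δ → ∑ i, dist (f (b i)) (f (a i)) < ε

/-- The map `Υ(s, τ) = (s, χ(s, τ))`. -/
def upsilon (χ : ℝ × ℝ → ℝ) (p : ℝ × ℝ) : ℝ × ℝ := (p.1, χ p)

/-- `(ω', χ)` is a partial Lagrangian parameterisation associated to `φ : ω → ℝ` and to
`∂_z φ + ∂_t (φ² / 2) = w`. The function `χ` only matters on `ω'`. -/
structure IsPartialLagrangianParam (ω : Set (ℝ × ℝ)) (φ : ℝ × ℝ → ℝ)
    (ω' : Set (ℝ × ℝ)) (χ : ℝ × ℝ → ℝ) : Prop where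
  isOpen : IsOpen ω'
  borel : Measurable (fun p : ω' => χ p)
  mapsTo : MapsTo (upsilon χ) ω' ω
  monotone : ∀ s : ℝ, MonotoneOn (fun τ => χ (s, τ)) {τ | (s, τ) ∈ ω'}
  absCont : ∀ τ s₁ s₂ : ℝ, (∀ s ∈ Ioo s₁ s₂, (s, τ) ∈ ω') →
    AbsolutelyContinuousOn (fun s => upsilon χ (s, τ)) (Ioo s₁ s₂)
  characteristic : ∀ τ s₁ s₂ : ℝ, (∀ s ∈ Ioo s₁ s₂, (s, τ) ∈ ω') →
    ∀ᵐ s ∂(volume.restrict (Ioo s₁ s₂)),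
      HasDerivAt (fun r => χ (r, τ)) (φ (upsilon χ (s, τ))) s

/-- A (full) Lagrangian parameterisation: for every `s`, the map `χ(s, ·)` is onto the section
`{t | (s, t) ∈ ω}`. -/
structure IsLagrangianParam (ω : Set (ℝ × ℝ)) (φ : ℝ × ℝ → ℝ)
    (ω' : Set (ℝ × ℝ)) (χ : ℝ × ℝ → ℝ) : Prop extends IsPartialLagrangianParam ω φ ω' χ where
  surjOn : ∀ s : ℝ, SurjOn (fun τ => χ (s, τ)) {τ | (s, τ) ∈ ω'} {t | (s, t) ∈ ω}

/-- A set is universally measurable if it is measurable with respect to (the completion of) every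
finite Borel measure. -/
def UniversallyMeasurableSet (S : Set (ℝ × ℝ)) : Prop :=
  ∀ μ : Measure (ℝ × ℝ), IsFiniteMeasure μ → NullMeasurableSet S μ

/-- The function `g : ω → ℝ` is universally measurable. -/
def UniversallyMeasurableOn (ω : Set (ℝ × ℝ)) (g : ℝ × ℝ → ℝ) : Prop :=
  ∀ B : Set ℝ, MeasurableSet B → UniversallyMeasurableSet (ω ∩ g ⁻¹' B)

/-- `Γ : (-δ, δ) → ω` is an integral curve of the vector field `∂_z + φ ∂_t`. -/
def IsCharacteristicCurve (ω : Set (ℝ × ℝ)) (φ : ℝ × ℝ → ℝ) (δ : ℝ) (Γ : ℝ → ℝ × ℝ) : Prop :=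
  ∀ s ∈ Ioo (-δ) δ, Γ s ∈ ω ∧ HasDerivAt Γ (1, φ (Γ s)) s

/-- `φ` admits the `∇^φ`-derivative `α` at `A`: along each integral curve of `∂_z + φ ∂_t` through
`A`, the function `φ` has derivative `α` at `A`. -/
def HasIntrinsicDerivAt (ω : Set (ℝ × ℝ)) (φ : ℝ × ℝ → ℝ) (α : ℝ) (A : ℝ × ℝ) : Prop :=
  ∀ (δ : ℝ) (Γ : ℝ → ℝ × ℝ), 0 < δ → IsCharacteristicCurve ω φ δ Γ → Γ 0 = A →
    HasDerivAt (fun s => φ (Γ s)) α 0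

/-- `φ` is a Lagrangian solution in `ω` of `W^φ φ = w`, where the source is prescribed by
the universally measurable function `w` along the curves of some full Lagrangian
parameterisation. -/
def IsLagrangianSolutionWith (ω : Set (ℝ × ℝ)) (φ w : ℝ × ℝ → ℝ) : Prop :=
  ContinuousOn φ ω ∧ UniversallyMeasurableOn ω w ∧
  (∃ (ω' : Set (ℝ × ℝ)) (χ : ℝ × ℝ → ℝ), IsLagrangianParam ω φ ω' χ ∧
    ∀ τ s₁ s₂ : ℝ, (∀ s ∈ Ioo s₁ s₂, (s, τ) ∈ ω') →
      AbsolutelyContinuousOn (fun s => φ (upsilon χ (s, τ))) (Ioo s₁ s₂) ∧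
      ∀ᵐ s ∂(volume.restrict (Ioo s₁ s₂)),
        HasDerivAt (fun r => φ (upsilon χ (r, τ))) (w (upsilon χ (s, τ))) s) ∧
  ∀ A ∈ ω, ∀ α : ℝ, HasIntrinsicDerivAt ω φ α A → w A = α

/-- `φ` is a Lagrangian solution in `ω`: the source function along the parameterisation is part of
what has to exist. -/
def IsLagrangianSolution (ω : Set (ℝ × ℝ)) (φ : ℝ × ℝ → ℝ) : Prop :=
  ∃ w : ℝ × ℝ → ℝ, IsLagrangianSolutionWith ω φ w

end BalanceLaw

end

/-! Both hypotheses enter only through one consequence: `φ` is continuous and Lipschitz, with one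
constant `C`, along every characteristic (`LipschitzAlong`). For intrinsic Lipschitz `φ` this
follows from the definition of `graphDist` at the endpoints of maximal oscillation along the curve.
For distributional solutions it is Dafermos' argument: mollify, and integrate the balance law over a
thin strip on one side of the characteristic. The flux through the sides of the strip is `-(β - c)²
/ 2`, where `c` and `β` are the values of `φ` on the curve and on the opposite side. This has a
favourable sign, and the two sides of the curve give the two inequalities.

Characteristics are not unique, so a monotone parameterisation needs an ordered family of them.
Peano solutions obtained as limits of strict supersolutions cannot be crossed upwards by any
characteristic. Two such leaves are therefore weakly ordered wherever both live. The relation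
`Leaf.Below` has no cycles, so counting points of a dense sequence that lie on lower leaves gives a
real-valued height that is strictly increasing for `Leaf.Below` (`Leaf.Below.height_lt`). The
parameterisation `paramChi` is the generalised inverse of the height. It is squeezed between leaves,
hence is itself a characteristic in `s` (`hasDerivAt_paramChi`).

The source is `maxSlope`, the largest slope of `φ` along the characteristics through a point.
Wherever all characteristics give the same derivative it equals that derivative. It is Borel on `ω`,
since its superlevel sets are countable unions of closed sets. On a given characteristic, a strictly
steeper competitor exists at only countably many points of differentiability
(`le_abs_sub_of_mem_gapTimes`). Hence `maxSlope` is the derivative of `φ` almost everywhere along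
every characteristic, in particular along the curves of `paramChi`. -/

namespace BalanceLaw

open Filter Topology Metric

/-! ### Peano existence with one-sided comparison -/

/-- Picard–Lindelöf solutions of vector fields lying slightly above `ψ`. -/
theorem exists_strict_supersolution {ψ : ℝ × ℝ → ℝ} (hψ : UniformContinuous ψ) {M : ℝ}
    (hM : ∀ p, |ψ p| ≤ M) (z t : ℝ) {δ ε : ℝ} (hδ : 0 < δ) (hε : 0 < ε) :
    ∃ (γ : ℝ → ℝ) (g : ℝ × ℝ → ℝ), γ z = t ∧ (∀ p, ψ p < g p ∧ g p < ψ p + ε) ∧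
      ∀ s ∈ Icc (z - δ) (z + δ),
        HasDerivWithinAt γ (g (s, γ s)) (Icc (z - δ) (z + δ)) s := by
  obtain ⟨g₀, hg₀, hg⟩ := hψ.exists_contDiff_dist_le (half_pos hε)
  have hM0 : 0 ≤ M := (abs_nonneg _).trans (hM 0)
  -- The speed is at most `M + ε`, so solutions stay within `a` of `t` during time `δ`.
  set a : ℝ := (M + ε) * δ with ha
  have ha0 : 0 ≤ a := by positivity
  obtain ⟨K, hK⟩ : ∃ K, LipschitzOnWith K g₀ (Icc (z - δ) (z + δ) ×ˢ closedBall t a) := by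
    apply (hg₀.of_le (by simp) : ContDiff ℝ 1 g₀).contDiffOn.exists_lipschitzOnWith
      (by simp) ((convex_Icc _ _).prod (convex_closedBall _ _))
      (isCompact_Icc.prod (isCompact_closedBall _ _))
  have hgb : ∀ p, ψ p < g₀ p + ε / 2 ∧ g₀ p + ε / 2 < ψ p + ε := by
    intro p
    have := hg p
    rw [Real.dist_eq, abs_lt] at this
    constructor <;> linarith
  have hPL : IsPicardLindelof (fun s x => g₀ (s, x) + ε / 2)
      (⟨z, by constructor <;> linarith⟩ : Icc (z - δ) (z + δ)) t ⟨a, ha0⟩ 0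
      ⟨M + ε, by positivity⟩ K := by
    refine ⟨fun s hs => ?_, fun x _ => ?_, fun s _ x _ => ?_, ?_⟩
    · refine LipschitzOnWith.of_dist_le_mul fun x hx y hy => ?_
      have := hK.dist_le_mul (s, x) ⟨hs, hx⟩ (s, y) ⟨hs, hy⟩
      simpa [Prod.dist_eq] using this
    · have := hg₀.continuous
      fun_prop
    · have h1 := hgb (s, x)
      have h2 := abs_le.1 (hM (s, x))
      rw [Real.norm_eq_abs, abs_le]
      constructor
      · change -(M + ε) ≤ _
        linarith
      · change _ ≤ M + ε
        linarith
    · change (M + ε) * max (z + δ - z) (z - (z - δ)) ≤ (M + ε) * δ - 0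
      rw [add_sub_cancel_left, sub_sub_cancel, max_self, sub_zero]
  obtain ⟨γ, hγ, hγ'⟩ := hPL.exists_eq_forall_mem_Icc_hasDerivWithinAt₀
  exact ⟨γ, fun p => g₀ p + ε / 2, hγ, hgb, hγ'⟩

/-- Peano's theorem for a bounded uniformly continuous field `ψ`, producing a solution that no
other solution crosses from below. -/
theorem exists_solution_not_crossed {ψ : ℝ × ℝ → ℝ} (hψ : UniformContinuous ψ) {M : ℝ}
    (hM : ∀ p, |ψ p| ≤ M) (z t : ℝ) {δ : ℝ} (hδ : 0 < δ) :
    ∃ γ : ℝ → ℝ, γ z = t ∧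
      (∀ s ∈ Ioo (z - δ) (z + δ), |γ s - t| ≤ (M + 1) * δ ∧ HasDerivAt γ (ψ (s, γ s)) s) ∧
      ∀ (η η' : ℝ → ℝ) (a b : ℝ), z - δ < a → a ≤ b → b < z + δ →
        (∀ s ∈ Icc a b, HasDerivAt η (η' s) s) →
        (∀ s ∈ Icc a b, |η s - t| ≤ (M + 1) * δ → η' s ≤ ψ (s, η s)) →
        η a < γ a → η b ≤ γ b := by
  have hM0 : 0 ≤ M := (abs_nonneg _).trans (hM 0)
  have hpos : ∀ n : ℕ, (0 : ℝ) < 1 / (n + 1) := fun n => by positivity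
  have hle1 : ∀ n : ℕ, (1 : ℝ) / (n + 1) ≤ 1 := fun n => by
    rw [div_le_one (by positivity)]; linarith [(Nat.cast_nonneg n : (0 : ℝ) ≤ n)]
  choose γ g hγz hg hγ using fun n : ℕ =>
    exists_strict_supersolution hψ hM z t hδ (hpos n)
  have hz : z ∈ Icc (z - δ) (z + δ) := by constructor <;> linarith
  have hlip : ∀ n, ∀ x ∈ Icc (z - δ) (z + δ), ∀ y ∈ Icc (z - δ) (z + δ),
      |γ n y - γ n x| ≤ (M + 1) * |y - x| := by
    intro n x hx y hy
    refine (convex_Icc (z - δ) (z + δ)).norm_image_sub_le_of_norm_hasDerivWithin_le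
      (hγ n) (fun s hs => ?_) hx hy
    have h1 := hg n (s, γ n s)
    have h2 := abs_le.1 (hM (s, γ n s))
    rw [Real.norm_eq_abs, abs_le]
    constructor <;> linarith [hle1 n]
  have hbox : ∀ n, ∀ x ∈ Icc (z - δ) (z + δ), |γ n x - t| ≤ (M + 1) * δ := by
    intro n x hx
    have := hlip n z hz x hx
    rw [hγz n] at this
    refine this.trans (mul_le_mul_of_nonneg_left ?_ (by linarith))
    rw [abs_le]; constructor <;> linarith [hx.1, hx.2]
  -- Pointwise limits along an ultrafilter replace the extraction of a subsequence; the common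
  -- Lipschitz bound `hlip` controls everything else.
  set U : Ultrafilter ℕ := hyperfilter ℕ
  have hU : (U : Filter ℕ) ≤ atTop := Nat.hyperfilter_le_atTop
  have hlim : ∀ s ∈ Icc (z - δ) (z + δ), ∃ x, Tendsto (fun n => γ n s) U (𝓝 x) := by
    intro s hs
    have hc := isCompact_closedBall (x := t) (r := (M + 1) * δ)
    obtain ⟨x, -, hx⟩ := hc.ultrafilter_le_nhds (U.map (fun n => γ n s)) (by
      rw [le_principal_iff]
      exact Filter.mem_map.2 (Filter.univ_mem' fun n => by
        simpa [Real.dist_eq] using hbox n s hs))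
    exact ⟨x, hx⟩
  choose! G hG using hlim
  refine ⟨G, ?_, fun s hs => ⟨?_, ?_⟩, ?_⟩
  · have h := hG z hz
    simp only [hγz] at h
    exact tendsto_nhds_unique h tendsto_const_nhds
  · have hs' := Ioo_subset_Icc_self hs
    exact le_of_tendsto ((hG s hs').sub_const t).abs (Eventually.of_forall fun n => hbox n s hs')
  · have hs' := Ioo_subset_Icc_self hs
    rw [hasDerivAt_iff_isLittleO, Asymptotics.isLittleO_iff]
    intro c hc
    obtain ⟨d, hd, hdψ⟩ := Metric.uniformContinuous_iff.1 hψ (c / 2) (half_pos hc)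
    -- Each `γ n` has speed at most `M + 1`, so this radius keeps its graph within `d` of its
    -- position at time `s`.
    have hd' : 0 < d / (M + 2) := by positivity
    filter_upwards [Ioo_mem_nhds hs.1 hs.2, Metric.ball_mem_nhds s hd'] with x hx hxd
    have hx' := Ioo_subset_Icc_self hx
    rw [mem_ball, Real.dist_eq] at hxd
    have hcont : Tendsto (fun n => ψ (s, γ n s)) U (𝓝 (ψ (s, G s))) :=
      (hψ.continuous.tendsto _).comp (tendsto_const_nhds.prodMk_nhds (hG s hs'))
    have hconv : Tendsto (fun n => |γ n x - γ n s - (x - s) * ψ (s, γ n s)|) U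
        (𝓝 |G x - G s - (x - s) * ψ (s, G s)|) :=
      (((hG x hx').sub (hG s hs')).sub (hcont.const_mul _)).abs
    have hsmall : ∀ᶠ n : ℕ in (U : Filter ℕ), (1 : ℝ) / (n + 1) < c / 2 :=
      hU ((tendsto_one_div_add_atTop_nhds_zero_nat).eventually (gt_mem_nhds (half_pos hc)))
    simp only [Real.norm_eq_abs, smul_eq_mul]
    refine le_of_tendsto hconv (hsmall.mono fun n hn => ?_)
    have hsub : uIcc s x ⊆ Icc (z - δ) (z + δ) := uIcc_subset_Icc hs' hx'
    have key := (convex_uIcc s x).norm_image_sub_le_of_norm_hasDerivWithin_le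
      (f := fun y => γ n y - y * ψ (s, γ n s)) (C := c)
      (f' := fun y => g n (y, γ n y) - 1 * ψ (s, γ n s))
      (fun y hy => ((hγ n y (hsub hy)).mono hsub).sub
        ((hasDerivWithinAt_id y _).mul_const _)) (fun y hy => ?_) left_mem_uIcc right_mem_uIcc
    · simp only [Real.norm_eq_abs] at key
      refine le_of_eq_of_le (congrArg _ ?_) key
      ring
    · have h1 := hg n (y, γ n y)
      have hys : |y - s| ≤ |x - s| := abs_sub_left_of_mem_uIcc hy
      have h3 : (M + 2) * |y - s| < d := by
        have := (lt_div_iff₀ (by linarith : (0 : ℝ) < M + 2)).1 (hys.trans_lt hxd)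
        linarith
      have h2 : dist (ψ (y, γ n y)) (ψ (s, γ n s)) < c / 2 := by
        apply hdψ
        rw [Prod.dist_eq, max_lt_iff]
        simp only [Real.dist_eq]
        have := hlip n s hs' y (hsub hy)
        have := abs_nonneg (y - s)
        constructor <;> nlinarith
      rw [Real.dist_eq, abs_lt] at h2
      rw [Real.norm_eq_abs, abs_le]
      constructor <;> linarith
  · intro η η' a b ha hab hb hη hη' hlt
    have haI : a ∈ Icc (z - δ) (z + δ) := ⟨ha.le, by linarith⟩
    have hbI : b ∈ Icc (z - δ) (z + δ) := ⟨by linarith, hb.le⟩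
    have hsubI : Icc a b ⊆ Ioo (z - δ) (z + δ) := fun s hs =>
      ⟨ha.trans_le hs.1, hs.2.trans_lt hb⟩
    have hd : ∀ n, ∀ s ∈ Icc a b, HasDerivAt (γ n) (g n (s, γ n s)) s := fun n s hs =>
      (hγ n s (Ioo_subset_Icc_self (hsubI hs))).hasDerivAt
        (Icc_mem_nhds (hsubI hs).1 (hsubI hs).2)
    refine ge_of_tendsto (hG b hbI) (((hG a haI).eventually (lt_mem_nhds hlt)).mono fun n hn => ?_)
    refine image_le_of_deriv_right_lt_deriv_boundary'
      (fun s hs => (hη s hs).continuousAt.continuousWithinAt)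
      (fun s hs => (hη s (Ico_subset_Icc_self hs)).hasDerivWithinAt) hn.le
      (fun s hs => (hd n s hs).continuousAt.continuousWithinAt)
      (fun s hs => (hd n s (Ico_subset_Icc_self hs)).hasDerivWithinAt) ?_ (right_mem_Icc.2 hab)
    intro s hs heq
    have hs' := Ico_subset_Icc_self hs
    -- Comparison with a strict supersolution only tests contact points, which lie in the box around
    -- `t`. This is why the inequality for `η'` is required in that box alone.
    have h1 := hη' s hs' (by rw [heq]; exact hbox n s (Ioo_subset_Icc_self (hsubI hs')))
    rw [heq] at h1
    exact h1.trans_lt (hg n _).1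

end BalanceLaw

/-! ### Characteristics of `φ` that are not crossed from below -/

namespace BalanceLaw

open Filter Topology Metric

/-- The graph of `γ` over `(a, b)` is a characteristic curve of `∂_z + φ ∂_t` in `ω`. -/
def IsCharacteristicOn (ω : Set (ℝ × ℝ)) (φ : ℝ × ℝ → ℝ) (γ : ℝ → ℝ) (a b : ℝ) : Prop :=
  ∀ s ∈ Ioo a b, (s, γ s) ∈ ω ∧ HasDerivAt γ (φ (s, γ s)) s

/-- No characteristic passes from below `γ` to above `γ` over `(a, b)`. -/
def IsUncrossedOn (ω : Set (ℝ × ℝ)) (φ : ℝ × ℝ → ℝ) (γ : ℝ → ℝ) (a b : ℝ) : Prop :=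
  ∀ (η : ℝ → ℝ) (c d : ℝ), IsCharacteristicOn ω φ η c d → ∀ x ∈ Ioo a b, ∀ y ∈ Ioo a b,
    x ∈ Ioo c d → y ∈ Ioo c d → x ≤ y → η x < γ x → η y ≤ γ y

theorem IsCharacteristicOn.mono {ω : Set (ℝ × ℝ)} {φ : ℝ × ℝ → ℝ} {γ : ℝ → ℝ} {a b c d : ℝ}
    (h : IsCharacteristicOn ω φ γ a b) (hac : a ≤ c) (hdb : d ≤ b) :
    IsCharacteristicOn ω φ γ c d :=
  fun s hs => h s ⟨hac.trans_lt hs.1, hs.2.trans_le hdb⟩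

theorem IsCharacteristicOn.continuousAt {ω : Set (ℝ × ℝ)} {φ : ℝ × ℝ → ℝ} {γ : ℝ → ℝ} {a b : ℝ}
    (h : IsCharacteristicOn ω φ γ a b) {s : ℝ} (hs : s ∈ Ioo a b) : ContinuousAt γ s :=
  (h s hs).2.continuousAt

/-- In the sup metric of `ℝ × ℝ` the ball is a square, and clamping the coordinates is a 1-Lipschitz
retraction onto it. -/
theorem exists_uniformContinuous_eqOn_closedBall {φ : ℝ × ℝ → ℝ} {A : ℝ × ℝ} {r : ℝ} (hr : 0 ≤ r)
    (hφ : ContinuousOn φ (closedBall A r)) :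
    ∃ (ψ : ℝ × ℝ → ℝ) (M : ℝ), UniformContinuous ψ ∧ (∀ p, |ψ p| ≤ M) ∧
      EqOn ψ φ (closedBall A r) := by
  have hK : IsCompact (closedBall A r) := isCompact_closedBall A r
  obtain ⟨M, hM⟩ := hK.exists_bound_of_continuousOn hφ
  let P : ℝ × ℝ → ℝ × ℝ := fun p =>
    (max (A.1 - r) (min (A.1 + r) p.1), max (A.2 - r) (min (A.2 + r) p.2))
  have hP : UniformContinuous P := by
    have : LipschitzWith (max 1 1) P :=
      ((LipschitzWith.prod_fst.const_min _).const_max _).prodMk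
        ((LipschitzWith.prod_snd.const_min _).const_max _)
    exact this.uniformContinuous
  have hPK : ∀ p, P p ∈ closedBall A r := by
    intro p
    rw [mem_closedBall, Prod.dist_eq, max_le_iff, Real.dist_eq, Real.dist_eq, abs_le, abs_le]
    refine ⟨⟨?_, ?_⟩, ⟨?_, ?_⟩⟩
    · linarith [le_max_left (A.1 - r) (min (A.1 + r) p.1)]
    · have : (P p).1 ≤ A.1 + r := max_le (by linarith) (min_le_left _ _)
      linarith
    · linarith [le_max_left (A.2 - r) (min (A.2 + r) p.2)]
    · have : (P p).2 ≤ A.2 + r := max_le (by linarith) (min_le_left _ _)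
      linarith
  have hPid : ∀ p ∈ closedBall A r, P p = p := by
    intro p hp
    rw [mem_closedBall, Prod.dist_eq, max_le_iff, Real.dist_eq, Real.dist_eq, abs_le, abs_le] at hp
    ext
    · change max _ _ = _
      rw [min_eq_right (by linarith), max_eq_right (by linarith)]
    · change max _ _ = _
      rw [min_eq_right (by linarith), max_eq_right (by linarith)]
  refine ⟨φ ∘ P, M, ?_, fun p => hM _ (hPK p), fun p hp => ?_⟩
  · rw [← uniformContinuousOn_univ]
    exact (hK.uniformContinuousOn_of_continuous hφ).comp hP.uniformContinuousOn
      (fun p _ => hPK p)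
  · rw [Function.comp_apply, hPid p hp]

/-- Local existence, with uniform length, of characteristics that are not crossed from below. -/
theorem exists_uncrossed_characteristic {ω : Set (ℝ × ℝ)} (hω : IsOpen ω) {φ : ℝ × ℝ → ℝ}
    (hφ : ContinuousOn φ ω) {A₀ : ℝ × ℝ} (hA₀ : A₀ ∈ ω) :
    ∃ δ > 0, ∀ᶠ A in 𝓝 A₀, ∃ γ : ℝ → ℝ, γ A.1 = A.2 ∧
      IsCharacteristicOn ω φ γ (A.1 - δ) (A.1 + δ) ∧
      IsUncrossedOn ω φ γ (A.1 - δ) (A.1 + δ) := by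
  obtain ⟨R, hR, hRω⟩ := nhds_basis_closedBall.mem_iff.1 (hω.mem_nhds hA₀)
  obtain ⟨ψ, M, hψ, hM, hψφ⟩ :=
    exists_uniformContinuous_eqOn_closedBall hR.le (hφ.mono hRω)
  have hM0 : 0 ≤ M := (abs_nonneg _).trans (hM 0)
  set r := R / 2 with hr
  have hr0 : 0 < r := by positivity
  -- With speed at most `M + 1`, curves starting in the half-radius ball stay in the ball of radius
  -- `R` for time `δ`. The length therefore does not depend on `A`.
  set δ := r / (M + 1) with hδ
  have hδ0 : 0 < δ := by positivity
  have hMδ : (M + 1) * δ = r := by rw [hδ]; field_simp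
  have hδr : δ ≤ r := by rw [← hMδ]; nlinarith
  refine ⟨δ, hδ0, Filter.eventually_of_mem (closedBall_mem_nhds A₀ hr0) fun A hA => ?_⟩
  obtain ⟨γ, hγ0, hγ, hNC⟩ := exists_solution_not_crossed hψ hM A.1 A.2 hδ0
  rw [hMδ] at hγ hNC
  rw [mem_closedBall, Prod.dist_eq, max_le_iff, Real.dist_eq, Real.dist_eq] at hA
  have hbox : ∀ s x, s ∈ Ioo (A.1 - δ) (A.1 + δ) → |x - A.2| ≤ r → (s, x) ∈ closedBall A₀ R := by
    intro s x hs hx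
    rw [mem_closedBall, Prod.dist_eq, max_le_iff, Real.dist_eq, Real.dist_eq]
    have h1 := abs_le.1 hA.1
    have h2 := abs_le.1 hA.2
    have h3 := abs_le.1 hx
    rw [abs_le, abs_le]
    simp only
    refine ⟨⟨?_, ?_⟩, ⟨?_, ?_⟩⟩ <;> linarith [hs.1, hs.2]
  refine ⟨γ, hγ0, fun s hs => ?_, ?_⟩
  · have hm := hbox s (γ s) hs (hγ s hs).1
    refine ⟨hRω hm, ?_⟩
    rw [← hψφ hm]
    exact (hγ s hs).2
  · intro η c d hη x hx y hy hxc hyc hxy hlt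
    have hsub : ∀ s ∈ Icc x y, s ∈ Ioo (A.1 - δ) (A.1 + δ) ∧ s ∈ Ioo c d := fun s hs =>
      ⟨⟨hx.1.trans_le hs.1, hs.2.trans_lt hy.2⟩, ⟨hxc.1.trans_le hs.1, hs.2.trans_lt hyc.2⟩⟩
    refine hNC η (fun s => φ (s, η s)) x y hx.1 hxy hy.2
      (fun s hs => (hη s (hsub s hs).2).2) (fun s hs hb => ?_) hlt
    rw [hψφ (hbox s (η s) (hsub s hs).1 hb)]

/-! ### Leaves and the acyclicity of their order -/

/-- A characteristic over a bounded interval that is not crossed from below. -/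
structure Leaf (ω : Set (ℝ × ℝ)) (φ : ℝ × ℝ → ℝ) where
  left : ℝ
  right : ℝ
  toFun : ℝ → ℝ
  isCharacteristicOn : IsCharacteristicOn ω φ toFun left right
  isUncrossedOn : IsUncrossedOn ω φ toFun left right

namespace Leaf

variable {ω : Set (ℝ × ℝ)} {φ : ℝ × ℝ → ℝ}

/-- The open interval over which the leaf lives. -/
def dom (P : Leaf ω φ) : Set ℝ := Ioo P.left P.right

/-- `P` is strictly below `Q` somewhere. -/
def Below (P Q : Leaf ω φ) : Prop := ∃ s ∈ P.dom ∩ Q.dom, P.toFun s < Q.toFun s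

theorem le_of_lt_of_le {P Q : Leaf ω φ} {s s' : ℝ} (hs : s ∈ P.dom ∩ Q.dom)
    (hs' : s' ∈ P.dom ∩ Q.dom) (hlt : P.toFun s < Q.toFun s) (hss : s ≤ s') :
    P.toFun s' ≤ Q.toFun s' :=
  Q.isUncrossedOn P.toFun _ _ P.isCharacteristicOn s hs.2 s' hs'.2 hs.1 hs'.1 hss hlt

/-- Forward in time `Q` is uncrossed. Backward in time, the reversed strict order would be carried
forward by the uncrossedness of `P` and contradict the order at `s`. -/
theorem le_of_lt {P Q : Leaf ω φ} {s s' : ℝ} (hs : s ∈ P.dom ∩ Q.dom)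
    (hs' : s' ∈ P.dom ∩ Q.dom) (hlt : P.toFun s < Q.toFun s) : P.toFun s' ≤ Q.toFun s' := by
  rcases le_total s s' with h | h
  · exact le_of_lt_of_le hs hs' hlt h
  · by_contra! hcon
    exact absurd (le_of_lt_of_le hs'.symm hs.symm hcon h) (not_le.2 hlt)

theorem Below.le {P Q : Leaf ω φ} (h : P.Below Q) {s : ℝ} (hs : s ∈ P.dom ∩ Q.dom) :
    P.toFun s ≤ Q.toFun s := by
  obtain ⟨s₀, hs₀, hlt⟩ := h
  exact le_of_lt hs₀ hs hlt

theorem not_below_self (P : Leaf ω φ) : ¬ P.Below P := fun ⟨_, _, h⟩ => lt_irrefl _ h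

/-- `Below` is transitive through a leaf that ends first. -/
theorem Below.trans_of_right_le {P Q R : Leaf ω φ} (h₁ : P.Below Q) (h₂ : Q.Below R)
    (hP : Q.right ≤ P.right) (hR : Q.right ≤ R.right) : P.Below R := by
  obtain ⟨s, hs, hlt⟩ := h₁
  obtain ⟨s', hs', hlt'⟩ := h₂
  have hm : ∀ x, x = max s s' → x ∈ P.dom ∧ x ∈ Q.dom ∧ x ∈ R.dom := by
    rintro x rfl
    have h1 : max s s' < Q.right := max_lt hs.2.2 hs'.1.2
    exact ⟨⟨hs.1.1.trans_le (le_max_left _ _), h1.trans_le hP⟩,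
      ⟨hs.2.1.trans_le (le_max_left _ _), h1⟩,
      ⟨hs'.2.1.trans_le (le_max_right _ _), h1.trans_le hR⟩⟩
  obtain ⟨m1, m2, m3⟩ := hm _ rfl
  refine ⟨max s s', ⟨m1, m3⟩, ?_⟩
  have l1 := le_of_lt hs ⟨m1, m2⟩ hlt
  have l2 := le_of_lt hs' ⟨m2, m3⟩ hlt'
  rcases max_choice s s' with h | h
  · rw [h] at l2 ⊢
    exact hlt.trans_le l2
  · rw [h] at l1 ⊢
    exact l1.trans_lt hlt'

/-- There is no cycle of leaves of length `n + 1`. -/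
theorem no_cycle (n : ℕ) : ∀ c : ℕ → Leaf ω φ,
    (∀ i ≤ n, (c i).Below (c (i + 1))) → c (n + 1) ≠ c 0 := by
  induction n with
  | zero =>
    intro c hc h
    have := hc 0 le_rfl
    rw [h] at this
    exact not_below_self _ this
  | succ n ih =>
    intro c hc hcyc
    -- The leaf that ends first can be dropped from the cycle: both of its neighbours outlive it, so
    -- they are comparable through it.
    obtain ⟨m, hm, hmin⟩ := Finset.exists_min_image (Finset.range (n + 2))
      (fun i => (c i).right) ⟨0, by simp⟩
    have hm' : m < n + 2 := by simpa using hm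
    have hmin' : ∀ i ≤ n + 2, (c m).right ≤ (c i).right := by
      intro i hi
      rcases hi.lt_or_eq with h | h
      · exact hmin i (by simpa using h)
      · rw [h, hcyc]
        exact hmin 0 (by simp)
    rcases Nat.eq_zero_or_pos m with h0 | h0
    -- The dropped leaf closes the cycle, so its neighbours are `c (n + 1)` and `c 1`, and the
    -- shortened cycle is shifted to start at `c 1`.
    · subst h0
      have hlast : (c (n + 1)).Below (c 1) := by
        have h1 : (c (n + 1)).Below (c 0) := by
          have := hc (n + 1) le_rfl
          rwa [hcyc] at this
        exact h1.trans_of_right_le (hc 0 (by omega)) (hmin' _ (by omega)) (hmin' _ (by omega))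
      refine ih (fun i => if i ≤ n then c (i + 1) else c 1) (fun i hi => ?_) (by simp)
      simp only [hi, if_true]
      by_cases h : i + 1 ≤ n
      · simpa [h] using hc (i + 1) (by omega)
      · obtain rfl : i = n := by omega
        simpa using hlast
    · refine ih (fun i => if i < m then c i else c (i + 1)) (fun i hi => ?_) ?_
      · by_cases h : i + 1 < m
        · simpa [h, show i < m by omega] using hc i (by omega)
        · by_cases h' : i < m
          · simp only [h, h', if_true, if_false]
            obtain rfl : m = i + 1 := by omega
            exact (hc i (by omega)).trans_of_right_le (hc (i + 1) (by omega))
              (hmin' _ (by omega)) (hmin' _ (by omega))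
          · simpa [h, h'] using hc (i + 1) (by omega)
      · simpa [h0, show ¬ n + 1 < m by omega] using hcyc

theorem exists_chain {P Q : Leaf ω φ} (h : Relation.TransGen Below P Q) :
    ∃ (n : ℕ) (c : ℕ → Leaf ω φ), (∀ i ≤ n, (c i).Below (c (i + 1))) ∧ c 0 = P ∧
      c (n + 1) = Q := by
  induction h with
  | @single Q h =>
    exact ⟨0, fun i => if i = 0 then P else Q, by simpa using h, by simp, by simp⟩
  | @tail Q R _ h ih =>
    obtain ⟨n, c, hc, h0, hn⟩ := ih
    refine ⟨n + 1, fun i => if i ≤ n + 1 then c i else R, fun i hi => ?_, by simpa using h0,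
      by simp⟩
    by_cases h' : i + 1 ≤ n + 1
    · simpa [h', hi] using hc i (by omega)
    · obtain rfl : i = n + 1 := by omega
      simpa [hn] using h

theorem not_transGen_below_self (P : Leaf ω φ) : ¬ Relation.TransGen Below P P := by
  intro h
  obtain ⟨n, c, hc, h0, hn⟩ := exists_chain h
  exact no_cycle n c hc (hn.trans h0.symm)

end Leaf

end BalanceLaw

/-! ### Quadratic estimates along characteristics, and the height of a leaf -/

namespace BalanceLaw

open Filter Topology Metric

/-- Along every characteristic curve in `ω`, the function `φ` is `C`-Lipschitz. -/
def LipschitzAlong (ω : Set (ℝ × ℝ)) (φ : ℝ × ℝ → ℝ) (C : ℝ) : Prop :=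
  ∀ (γ : ℝ → ℝ) (a b : ℝ), IsCharacteristicOn ω φ γ a b → ∀ x ∈ Ioo a b, ∀ y ∈ Ioo a b,
    |φ (y, γ y) - φ (x, γ x)| ≤ C * |y - x|

theorem LipschitzAlong.quadratic {ω : Set (ℝ × ℝ)} {φ : ℝ × ℝ → ℝ} {C : ℝ}
    (hC : LipschitzAlong ω φ C) (hC0 : 0 ≤ C) {γ : ℝ → ℝ} {a b : ℝ}
    (hγ : IsCharacteristicOn ω φ γ a b)
    {x y : ℝ} (hx : x ∈ Ioo a b) (hy : y ∈ Ioo a b) :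
    |γ y - γ x - φ (x, γ x) * (y - x)| ≤ C * (y - x) ^ 2 := by
  have hsub : uIcc x y ⊆ Ioo a b := (ordConnected_Ioo).uIcc_subset hx hy
  have key := (convex_uIcc x y).norm_image_sub_le_of_norm_hasDerivWithin_le
    (f := fun s => γ s - s * φ (x, γ x)) (C := C * |y - x|)
    (f' := fun s => φ (s, γ s) - 1 * φ (x, γ x))
    (fun s hs => ((hγ s (hsub hs)).2.hasDerivWithinAt).sub
      ((hasDerivWithinAt_id s _).mul_const _)) (fun s hs => ?_) left_mem_uIcc right_mem_uIcc
  · rw [Real.norm_eq_abs, Real.norm_eq_abs, mul_assoc, abs_mul_abs_self] at key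
    calc _ = |γ y - y * φ (x, γ x) - (γ x - x * φ (x, γ x))| := by ring_nf
      _ ≤ _ := key
      _ = _ := by ring
  · rw [one_mul]
    exact (hC γ a b hγ x hx s (hsub hs)).trans
      (mul_le_mul_of_nonneg_left (abs_sub_left_of_mem_uIcc hs) hC0)

/-- Encoding the characteristic equation by a quadratic inequality makes it stable under pointwise
limits and squeezing. -/
theorem hasDerivAt_of_quadratic {γ : ℝ → ℝ} {s v C : ℝ}
    (h : ∀ᶠ x in 𝓝 s, |γ x - γ s - v * (x - s)| ≤ C * (x - s) ^ 2) : HasDerivAt γ v s := by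
  rw [hasDerivAt_iff_isLittleO, Asymptotics.isLittleO_iff]
  intro c hc
  have hsmall : ∀ᶠ x in 𝓝 s, C * |x - s| < c := by
    have : ContinuousAt (fun x => C * |x - s|) s := by fun_prop
    exact this.eventually (gt_mem_nhds (by simpa using hc))
  filter_upwards [h, hsmall] with x hx hxc
  rw [Real.norm_eq_abs, Real.norm_eq_abs, smul_eq_mul, mul_comm (x - s)]
  refine hx.trans ?_
  rw [← sq_abs, pow_two, ← mul_assoc]
  exact mul_le_mul_of_nonneg_right hxc.le (abs_nonneg _)

namespace Leaf

variable {ω : Set (ℝ × ℝ)} {φ : ℝ × ℝ → ℝ}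

/-- The leaf `P` passes through the point `A`. -/
def Through (P : Leaf ω φ) (A : ℝ × ℝ) : Prop := A.1 ∈ P.dom ∧ P.toFun A.1 = A.2

theorem exists_uniform_through (hω : IsOpen ω) (hφ : ContinuousOn φ ω) {A₀ : ℝ × ℝ}
    (hA₀ : A₀ ∈ ω) : ∃ δ > 0, ∀ᶠ A in 𝓝 A₀, ∃ P : Leaf ω φ, P.Through A ∧
      P.dom = Ioo (A.1 - δ) (A.1 + δ) := by
  obtain ⟨δ, hδ, h⟩ := exists_uncrossed_characteristic hω hφ hA₀
  refine ⟨δ, hδ, h.mono fun A ⟨γ, h1, h2, h3⟩ => ⟨⟨_, _, γ, h2, h3⟩, ⟨?_, h1⟩, rfl⟩⟩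
  constructor <;> simp only <;> linarith

theorem exists_through (hω : IsOpen ω) (hφ : ContinuousOn φ ω) {A : ℝ × ℝ}
    (hA : A ∈ ω) : ∃ P : Leaf ω φ, P.Through A := by
  obtain ⟨δ, _, h⟩ := exists_uniform_through hω hφ hA
  obtain ⟨P, hP, _⟩ := h.self_of_nhds
  exact ⟨P, hP⟩

theorem isOpen_dom (P : Leaf ω φ) : IsOpen P.dom := isOpen_Ioo

theorem continuousAt (P : Leaf ω φ) {s : ℝ} (hs : s ∈ P.dom) : ContinuousAt P.toFun s :=
  P.isCharacteristicOn.continuousAt hs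

theorem mem (P : Leaf ω φ) {s : ℝ} (hs : s ∈ P.dom) : (s, P.toFun s) ∈ ω :=
  (P.isCharacteristicOn s hs).1

/-- The members of a dense sequence lying on leaves below `P`. -/
def lowerIndices (P : Leaf ω φ) : Set ℕ :=
  {k | ∃ P₀ : Leaf ω φ, P₀.Through (TopologicalSpace.denseSeq (ℝ × ℝ) k) ∧
    Relation.TransGen Below P₀ P}

/-- A numerical height of leaves, strictly monotone with respect to `Below`. -/
noncomputable def height (P : Leaf ω φ) : ℝ :=
  ∑' k, P.lowerIndices.indicator (fun k => (1 / 2 : ℝ) ^ k) k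

/-- Everything below `P` is below `Q`, so no term of the sum is lost. A dense point strictly between
the two leaves is gained: a leaf through it is below `Q`, and if it were also below `P` it would
close a cycle. -/
theorem Below.height_lt (hω : IsOpen ω) (hφ : ContinuousOn φ ω) {P Q : Leaf ω φ}
    (h : P.Below Q) : P.height < Q.height := by
  obtain ⟨s, ⟨hsP, hsQ⟩, hlt⟩ := id h
  -- The vertical segment from `P` to `Q` may leave `ω`, so `t` is taken close to `Q`.
  obtain ⟨t, ht1, ht2, htω⟩ : ∃ t, P.toFun s < t ∧ t < Q.toFun s ∧ (s, t) ∈ ω := by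
    have hc : ContinuousAt (fun t : ℝ => (s, t)) (Q.toFun s) := by fun_prop
    have h1 : ∀ᶠ t in 𝓝[<] (Q.toFun s), (s, t) ∈ ω :=
      (hc.eventually (hω.mem_nhds (Q.mem hsQ))).filter_mono nhdsWithin_le_nhds
    have h2 : ∀ᶠ t in 𝓝[<] (Q.toFun s), P.toFun s < t :=
      (lt_mem_nhds hlt).filter_mono nhdsWithin_le_nhds
    obtain ⟨t, h3, h4, h5⟩ := (h1.and (h2.and self_mem_nhdsWithin)).exists
    exact ⟨t, h4, h5, h3⟩
  have hV : ∀ᶠ A : ℝ × ℝ in 𝓝 (s, t), A ∈ ω ∧ A.1 ∈ P.dom ∧ A.1 ∈ Q.dom ∧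
      P.toFun A.1 < A.2 ∧ A.2 < Q.toFun A.1 := by
    have cP : ContinuousAt (fun A : ℝ × ℝ => P.toFun A.1) (s, t) :=
      (P.continuousAt hsP).comp (f := Prod.fst) (x := (s, t)) continuousAt_fst
    have cQ : ContinuousAt (fun A : ℝ × ℝ => Q.toFun A.1) (s, t) :=
      (Q.continuousAt hsQ).comp (f := Prod.fst) (x := (s, t)) continuousAt_fst
    exact (hω.eventually_mem htω).and
      ((continuousAt_fst.eventually (P.isOpen_dom.eventually_mem hsP)).and
      ((continuousAt_fst.eventually (Q.isOpen_dom.eventually_mem hsQ)).and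
      ((cP.eventually_lt continuousAt_snd ht1).and (continuousAt_snd.eventually_lt cQ ht2))))
  obtain ⟨k, hkω, hkP, hkQ, hk1, hk2⟩ :=
    (TopologicalSpace.denseRange_denseSeq (ℝ × ℝ)).exists_mem_open isOpen_interior
      ⟨_, mem_interior_iff_mem_nhds.2 hV⟩ |>.imp fun k hk => interior_subset hk
  have hsum : Summable (fun k => (1 / 2 : ℝ) ^ k) := summable_geometric_two
  have hnn : ∀ k : ℕ, (0 : ℝ) ≤ (1 / 2) ^ k := fun k => by positivity
  refine Summable.tsum_lt_tsum (i := k) (fun j => ?_) ?_ (hsum.indicator _) (hsum.indicator _)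
  · refine indicator_le_indicator_of_subset ?_ hnn j
    rintro j ⟨P₀, h1, h2⟩
    exact ⟨P₀, h1, h2.tail h⟩
  · have hPk : k ∉ P.lowerIndices := by
      rintro ⟨P₀, ⟨h1, h2⟩, h3⟩
      refine not_transGen_below_self P₀ (h3.tail ⟨_, ⟨hkP, h1⟩, ?_⟩)
      rwa [h2]
    have hQk : k ∈ Q.lowerIndices := by
      obtain ⟨P₀, h1, h2⟩ := exists_through hω hφ hkω
      refine ⟨P₀, ⟨h1, h2⟩, .single ⟨_, ⟨h1, hkQ⟩, ?_⟩⟩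
      rwa [h2]
    rw [indicator_of_notMem hPk, indicator_of_mem hQk]
    positivity

end Leaf

/-! ### The parameterisation as generalised inverse of the height -/

section Parameterisation

variable (ω : Set (ℝ × ℝ)) (φ : ℝ × ℝ → ℝ)

/-- The domain of the parameterisation: heights strictly between those of two leaves bounding a
vertical segment contained in `ω`. -/
def paramDomain : Set (ℝ × ℝ) :=
  {p | ∃ P Q : Leaf ω φ, p.1 ∈ P.dom ∧ p.1 ∈ Q.dom ∧ P.toFun p.1 < Q.toFun p.1 ∧
    (∀ t ∈ Icc (P.toFun p.1) (Q.toFun p.1), (p.1, t) ∈ ω) ∧ P.height < p.2 ∧ p.2 < Q.height}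

/-- Generalised inverse of the height. -/
noncomputable def paramChi (p : ℝ × ℝ) : ℝ :=
  sSup {t | ∃ P : Leaf ω φ, P.Through (p.1, t) ∧ P.height ≤ p.2}

variable {ω φ}

theorem le_of_height_le (hω : IsOpen ω) (hφ : ContinuousOn φ ω)
    {P Q : Leaf ω φ} {s : ℝ} (hP : s ∈ P.dom) (hQ : s ∈ Q.dom)
    (h : P.height ≤ Q.height) : P.toFun s ≤ Q.toFun s := by
  by_contra! hlt
  exact absurd (Leaf.Below.height_lt hω hφ ⟨s, ⟨hQ, hP⟩, hlt⟩) (not_lt.2 h)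

theorem bddAbove_of_mem_paramDomain (hω : IsOpen ω) (hφ : ContinuousOn φ ω)
    {p : ℝ × ℝ} (hp : p ∈ paramDomain ω φ) :
    BddAbove {t | ∃ P : Leaf ω φ, P.Through (p.1, t) ∧ P.height ≤ p.2} := by
  obtain ⟨P, Q, hP, hQ, -, -, -, h2⟩ := hp
  refine ⟨Q.toFun p.1, ?_⟩
  rintro t ⟨R, ⟨hR, hRt⟩, hh⟩
  rw [show t = R.toFun p.1 from hRt.symm]
  exact le_of_height_le hω hφ hR hQ (hh.trans h2.le)

theorem le_paramChi (hω : IsOpen ω) (hφ : ContinuousOn φ ω)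
    {p : ℝ × ℝ} (hp : p ∈ paramDomain ω φ) {R : Leaf ω φ} (hR : p.1 ∈ R.dom)
    (h : R.height ≤ p.2) : R.toFun p.1 ≤ paramChi ω φ p :=
  le_csSup (bddAbove_of_mem_paramDomain hω hφ hp) ⟨R, ⟨hR, rfl⟩, h⟩

theorem nonempty_of_mem_paramDomain {p : ℝ × ℝ} (hp : p ∈ paramDomain ω φ) :
    {t | ∃ P : Leaf ω φ, P.Through (p.1, t) ∧ P.height ≤ p.2}.Nonempty := by
  obtain ⟨P, Q, hP, hQ, -, -, h1, -⟩ := hp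
  exact ⟨P.toFun p.1, P, ⟨hP, rfl⟩, h1.le⟩

theorem paramChi_le (hω : IsOpen ω) (hφ : ContinuousOn φ ω)
    {p : ℝ × ℝ} (hp : p ∈ paramDomain ω φ) {R : Leaf ω φ} (hR : p.1 ∈ R.dom)
    (h : p.2 ≤ R.height) : paramChi ω φ p ≤ R.toFun p.1 := by
  refine csSup_le (nonempty_of_mem_paramDomain hp) ?_
  rintro t ⟨T, ⟨hT, hTt⟩, hh⟩
  rw [show t = T.toFun p.1 from hTt.symm]
  exact le_of_height_le hω hφ hT hR (hh.trans h)

theorem height_lt_of_lt_paramChi (hω : IsOpen ω) (hφ : ContinuousOn φ ω)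
    {p : ℝ × ℝ} (hp : p ∈ paramDomain ω φ) {R : Leaf ω φ}
    (hR : p.1 ∈ R.dom) (h : R.toFun p.1 < paramChi ω φ p) : R.height < p.2 := by
  obtain ⟨t, ⟨T, ⟨hT, hTt⟩, hh⟩, hlt⟩ :=
    exists_lt_of_lt_csSup (nonempty_of_mem_paramDomain hp) h
  refine (Leaf.Below.height_lt hω hφ ⟨p.1, ⟨hR, hT⟩, ?_⟩).trans_le hh
  exact hlt.trans_eq hTt.symm

theorem lt_height_of_paramChi_lt (hω : IsOpen ω) (hφ : ContinuousOn φ ω)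
    {p : ℝ × ℝ} (hp : p ∈ paramDomain ω φ) {R : Leaf ω φ}
    (hR : p.1 ∈ R.dom) (h : paramChi ω φ p < R.toFun p.1) : p.2 < R.height := by
  by_contra! hle
  exact absurd (le_paramChi hω hφ hp hR hle) (not_le.2 h)

theorem paramChi_mem (hω : IsOpen ω) (hφ : ContinuousOn φ ω)
    {p : ℝ × ℝ} (hp : p ∈ paramDomain ω φ) : (p.1, paramChi ω φ p) ∈ ω := by
  obtain ⟨P, Q, hP, hQ, -, hω', h1, h2⟩ := id hp
  exact hω' _ ⟨le_paramChi hω hφ hp hP h1.le, paramChi_le hω hφ hp hQ h2.le⟩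

theorem isOpen_paramDomain (hω : IsOpen ω) : IsOpen (paramDomain ω φ) := by
  rw [isOpen_iff_mem_nhds]
  rintro ⟨s, τ⟩ ⟨P, Q, hP, hQ, hlt, hseg, h1, h2⟩
  simp only at hP hQ hlt hseg h1 h2
  -- Rescaling the moving vertical segment to `[0, 1]` lets compactness of a fixed interval give
  -- uniformity in `x`.
  have hs : ∀ᶠ x in 𝓝 s, x ∈ P.dom ∧ x ∈ Q.dom ∧ P.toFun x < Q.toFun x ∧
      ∀ l ∈ Icc (0 : ℝ) 1, (x, P.toFun x + l * (Q.toFun x - P.toFun x)) ∈ ω := by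
    refine (P.isOpen_dom.eventually_mem hP).and ((Q.isOpen_dom.eventually_mem hQ).and
      (((P.continuousAt hP).eventually_lt (Q.continuousAt hQ) hlt).and ?_))
    refine isCompact_Icc.eventually_forall_of_forall_eventually fun l hl => ?_
    have cP : ContinuousAt (fun A : ℝ × ℝ => P.toFun A.1) (s, l) :=
      (P.continuousAt hP).comp (f := Prod.fst) (x := (s, l)) continuousAt_fst
    have cQ : ContinuousAt (fun A : ℝ × ℝ => Q.toFun A.1) (s, l) :=
      (Q.continuousAt hQ).comp (f := Prod.fst) (x := (s, l)) continuousAt_fst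
    have hc : ContinuousAt (fun A : ℝ × ℝ =>
        (A.1, P.toFun A.1 + A.2 * (Q.toFun A.1 - P.toFun A.1))) (s, l) := by fun_prop
    refine hc.eventually (hω.mem_nhds (hseg _ ⟨?_, ?_⟩)) <;> simp only <;>
      nlinarith [hl.1, hl.2]
  filter_upwards [(continuousAt_fst (p := ((s, τ) : ℝ × ℝ))).eventually hs,
    (continuousAt_snd (p := ((s, τ) : ℝ × ℝ))).eventually (lt_mem_nhds h1),
    (continuousAt_snd (p := ((s, τ) : ℝ × ℝ))).eventually (gt_mem_nhds h2)]
    with p ⟨hp1, hp2, hp3, hp4⟩ hp5 hp6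
  refine ⟨P, Q, hp1, hp2, hp3, fun t ht => ?_, hp5, hp6⟩
  have hd : 0 < Q.toFun p.1 - P.toFun p.1 := sub_pos.2 hp3
  have := hp4 ((t - P.toFun p.1) / (Q.toFun p.1 - P.toFun p.1))
    ⟨div_nonneg (by linarith [ht.1]) hd.le, (div_le_one hd).2 (by linarith [ht.2])⟩
  rwa [div_mul_cancel₀ _ hd.ne', add_sub_cancel] at this

theorem eventually_mem_vertical (hω : IsOpen ω) {s t : ℝ} (h : (s, t) ∈ ω) :
    ∀ᶠ x in 𝓝 t, (s, x) ∈ ω := by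
  have hc : ContinuousAt (fun t : ℝ => (s, t)) t := by fun_prop
  exact hc.eventually (hω.mem_nhds h)

/-- Every point of `ω` lies on a leaf. Leaves through points just below and just above the value
have heights strictly on either side of `p.2`, and by continuity they trap the values at nearby
points. Jumps of the height only produce plateaux. -/
theorem continuousOn_paramChi (hω : IsOpen ω) (hφ : ContinuousOn φ ω) :
    ContinuousOn (paramChi ω φ) (paramDomain ω φ) := by
  intro p hp
  refine ContinuousAt.continuousWithinAt ?_
  have hopen := (isOpen_paramDomain hω).mem_nhds hp
  have hmem := eventually_mem_vertical hω (paramChi_mem hω hφ hp)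
  refine tendsto_order.2 ⟨fun a ha => ?_, fun a ha => ?_⟩
  · obtain ⟨t, ht, hta, htχ⟩ := ((hmem.filter_mono nhdsWithin_le_nhds).and
      (((lt_mem_nhds ha).filter_mono nhdsWithin_le_nhds).and
        (self_mem_nhdsWithin (s := Iio (paramChi ω φ p))))).exists
    obtain ⟨R, hR, hRt⟩ := Leaf.exists_through hω hφ ht
    simp only at hR hRt
    have hRh := height_lt_of_lt_paramChi hω hφ hp hR (hRt.trans_lt htχ)
    filter_upwards [hopen, continuousAt_fst.eventually (R.isOpen_dom.mem_nhds hR),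
      continuousAt_snd.eventually (lt_mem_nhds hRh),
      continuousAt_fst.eventually ((R.continuousAt hR).eventually
        (lt_mem_nhds (hRt.symm ▸ hta : a < R.toFun p.1)))] with q hq hq1 hq2 hq3
    exact lt_of_lt_of_le hq3 (le_paramChi hω hφ hq hq1 hq2.le)
  · obtain ⟨t, ht, hta, htχ⟩ := ((hmem.filter_mono nhdsWithin_le_nhds).and
      (((gt_mem_nhds ha).filter_mono nhdsWithin_le_nhds).and
        (self_mem_nhdsWithin (s := Ioi (paramChi ω φ p))))).exists
    obtain ⟨R, hR, hRt⟩ := Leaf.exists_through hω hφ ht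
    simp only at hR hRt
    have hRh := lt_height_of_paramChi_lt hω hφ hp hR (lt_of_lt_of_eq htχ hRt.symm)
    filter_upwards [hopen, continuousAt_fst.eventually (R.isOpen_dom.mem_nhds hR),
      continuousAt_snd.eventually (gt_mem_nhds hRh),
      continuousAt_fst.eventually ((R.continuousAt hR).eventually
        (gt_mem_nhds (hRt.symm ▸ hta : R.toFun p.1 < a)))] with q hq hq1 hq2 hq3
    exact lt_of_le_of_lt (paramChi_le hω hφ hq hq1 hq2.le) hq3

theorem monotoneOn_paramChi (hω : IsOpen ω) (hφ : ContinuousOn φ ω) (s : ℝ) :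
    MonotoneOn (fun τ => paramChi ω φ (s, τ)) {τ | (s, τ) ∈ paramDomain ω φ} := by
  intro τ hτ τ' hτ' hle
  refine csSup_le_csSup (bddAbove_of_mem_paramDomain hω hφ hτ')
    (nonempty_of_mem_paramDomain hτ) ?_
  rintro t ⟨P, h1, h2⟩
  exact ⟨P, h1, h2.trans hle⟩

/-- The height of any leaf through the point is a preimage; leaves through `t - ε` and `t + ε` put
it in the domain. -/
theorem surjOn_paramChi (hω : IsOpen ω) (hφ : ContinuousOn φ ω) (s : ℝ) :
    SurjOn (fun τ => paramChi ω φ (s, τ)) {τ | (s, τ) ∈ paramDomain ω φ} {t | (s, t) ∈ ω} := by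
  intro t ht
  obtain ⟨ε, hε, hball⟩ := nhds_basis_closedBall.mem_iff.1 (eventually_mem_vertical hω ht)
  rw [Real.closedBall_eq_Icc] at hball
  obtain ⟨P, hP, hPt⟩ := Leaf.exists_through hω hφ (hball ⟨le_rfl, by linarith⟩ : (s, t - ε) ∈ ω)
  obtain ⟨Q, hQ, hQt⟩ := Leaf.exists_through hω hφ (hball ⟨by linarith, le_rfl⟩ : (s, t + ε) ∈ ω)
  obtain ⟨R, hR, hRt⟩ := Leaf.exists_through hω hφ ht
  simp only at hP hPt hQ hQt hR hRt
  have hmem : (s, R.height) ∈ paramDomain ω φ := by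
    refine ⟨P, Q, hP, hQ, by simp only; linarith, fun x hx => hball ?_, ?_, ?_⟩
    · simpa [hPt, hQt] using hx
    · exact Leaf.Below.height_lt hω hφ ⟨s, ⟨hP, hR⟩, by linarith⟩
    · exact Leaf.Below.height_lt hω hφ ⟨s, ⟨hR, hQ⟩, by linarith⟩
  refine ⟨R.height, hmem, le_antisymm ?_ ?_⟩
  · exact (paramChi_le hω hφ hmem hR le_rfl).trans_eq hRt
  · exact hRt.symm.trans_le (le_paramChi hω hφ hmem hR le_rfl)

/-- A leaf through `(s, t)` with `t < χ` stays weakly below `paramChi` at height `τ`, and one with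
`t > χ` weakly above. Each obeys the quadratic estimate with the same `C`, so `t → χ` from both
sides squeezes the curve between two tangent parabolas. The uniform length of leaves is what allows
`x` to be fixed while `t` varies. -/
theorem hasDerivAt_paramChi (hω : IsOpen ω) (hφ : ContinuousOn φ ω)
    {C : ℝ} (hC : LipschitzAlong ω φ C) (hC0 : 0 ≤ C) {s τ : ℝ}
    (hp : (s, τ) ∈ paramDomain ω φ) :
    HasDerivAt (fun r => paramChi ω φ (r, τ)) (φ (s, paramChi ω φ (s, τ))) s := by
  have hχ := paramChi_mem hω hφ hp
  set χ := paramChi ω φ (s, τ) with hχdef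
  simp only at hχ
  obtain ⟨δ, hδ, hleaf⟩ := Leaf.exists_uniform_through hω hφ hχ
  have hc : ContinuousAt (fun t : ℝ => (s, t)) χ := by fun_prop
  have hleaf' := hc.eventually hleaf
  have hc' : ContinuousAt (fun r : ℝ => (r, τ)) s := by fun_prop
  have hφc : ContinuousAt (fun t => φ (s, t)) χ :=
    (hφ.continuousAt (hω.mem_nhds hχ)).comp (f := fun t => (s, t)) hc
  refine hasDerivAt_of_quadratic (C := C) ?_
  filter_upwards [hc'.eventually ((isOpen_paramDomain hω).mem_nhds hp),
    Ioo_mem_nhds (sub_lt_self s hδ) (lt_add_of_pos_right s hδ)] with x hx hxδ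
  have hsδ : s ∈ Ioo (s - δ) (s + δ) := by constructor <;> linarith
  rw [abs_le]
  constructor
  · have hev : ∀ᶠ t in 𝓝[<] χ,
        t + φ (s, t) * (x - s) - C * (x - s) ^ 2 ≤ paramChi ω φ (x, τ) := by
      filter_upwards [hleaf'.filter_mono nhdsWithin_le_nhds, self_mem_nhdsWithin]
        with t ⟨R, ⟨hR, hRt⟩, hdom⟩ hlt
      simp only at hR hRt hdom
      have h1 := height_lt_of_lt_paramChi hω hφ hp hR (hRt.trans_lt hlt)
      have hxR : x ∈ R.dom := hdom ▸ hxδ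
      have h2 := le_paramChi hω hφ (p := (x, τ)) hx hxR h1.le
      have h3 := abs_le.1 (hC.quadratic hC0 R.isCharacteristicOn hR hxR)
      rw [hRt] at h3
      simp only at h2
      linarith [h3.1]
    have hcont : ContinuousAt (fun t => t + φ (s, t) * (x - s) - C * (x - s) ^ 2) χ :=
      (continuousAt_id.add (hφc.mul_const _)).sub continuousAt_const
    have := le_of_tendsto (hcont.tendsto.mono_left nhdsWithin_le_nhds) hev
    linarith
  · have hev : ∀ᶠ t in 𝓝[>] χ,
        paramChi ω φ (x, τ) ≤ t + φ (s, t) * (x - s) + C * (x - s) ^ 2 := by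
      filter_upwards [hleaf'.filter_mono nhdsWithin_le_nhds, self_mem_nhdsWithin]
        with t ⟨R, ⟨hR, hRt⟩, hdom⟩ hlt
      simp only at hR hRt hdom
      have h1 := lt_height_of_paramChi_lt hω hφ hp hR (lt_of_lt_of_eq hlt hRt.symm)
      have hxR : x ∈ R.dom := hdom ▸ hxδ
      have h2 := paramChi_le hω hφ (p := (x, τ)) hx hxR h1.le
      have h3 := abs_le.1 (hC.quadratic hC0 R.isCharacteristicOn hR hxR)
      rw [hRt] at h3
      simp only at h2
      linarith [h3.2]
    have hcont : ContinuousAt (fun t => t + φ (s, t) * (x - s) + C * (x - s) ^ 2) χ :=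
      (continuousAt_id.add (hφc.mul_const _)).add continuousAt_const
    have := ge_of_tendsto (hcont.tendsto.mono_left nhdsWithin_le_nhds) hev
    linarith

end Parameterisation

end BalanceLaw

/-! ### The maximal slope as source function -/

namespace BalanceLaw

open Filter Topology Metric

/-- Some characteristic through `A`, of radius `δ`, along which the increments of `φ` from `A` have
slope at least `v`. -/
def HasSubslopeOn (ω : Set (ℝ × ℝ)) (φ : ℝ × ℝ → ℝ) (v δ : ℝ) (A : ℝ × ℝ) : Prop :=
  ∃ γ : ℝ → ℝ, γ A.1 = A.2 ∧ IsCharacteristicOn ω φ γ (A.1 - δ) (A.1 + δ) ∧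
    ∀ s ∈ Ioo (A.1 - δ) (A.1 + δ),
      (A.1 ≤ s → v * (s - A.1) ≤ φ (s, γ s) - φ A) ∧
      (s ≤ A.1 → φ (s, γ s) - φ A ≤ v * (s - A.1))

/-- The supremum of the slopes of `φ` along the characteristics through a point. -/
noncomputable def maxSlope (ω : Set (ℝ × ℝ)) (φ : ℝ × ℝ → ℝ) (A : ℝ × ℝ) : ℝ :=
  sSup {v | ∃ δ > 0, HasSubslopeOn ω φ v δ A}

variable {ω : Set (ℝ × ℝ)} {φ : ℝ × ℝ → ℝ} {C : ℝ}

theorem HasSubslopeOn.anti {v δ δ' : ℝ} {A : ℝ × ℝ} (h : HasSubslopeOn ω φ v δ A) (hδ : δ' ≤ δ) :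
    HasSubslopeOn ω φ v δ' A := by
  obtain ⟨γ, h1, h2, h3⟩ := h
  exact ⟨γ, h1, h2.mono (by linarith) (by linarith),
    fun s hs => h3 s ⟨by linarith [hs.1], by linarith [hs.2]⟩⟩

theorem HasSubslopeOn.mem {v δ : ℝ} (hδ : 0 < δ) {A : ℝ × ℝ} (h : HasSubslopeOn ω φ v δ A) :
    A ∈ ω := by
  obtain ⟨γ, h1, h2, -⟩ := h
  have := (h2 A.1 ⟨by linarith, by linarith⟩).1
  rwa [h1] at this

theorem eventually_slope_bounds {f : ℝ → ℝ} {d v s : ℝ} (hf : HasDerivAt f d s) (hv : v < d) :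
    ∀ᶠ r in 𝓝 s, (s ≤ r → v * (r - s) ≤ f r - f s) ∧ (r ≤ s → f r - f s ≤ v * (r - s)) := by
  rw [hasDerivAt_iff_isLittleO, Asymptotics.isLittleO_iff] at hf
  filter_upwards [hf (sub_pos.2 hv)] with r hr
  rw [Real.norm_eq_abs, Real.norm_eq_abs, smul_eq_mul, abs_le] at hr
  constructor
  · intro h
    rw [abs_of_nonneg (sub_nonneg.2 h)] at hr
    linarith [hr.1]
  · intro h
    rw [abs_of_nonpos (sub_nonpos.2 h)] at hr
    linarith [hr.2]

theorem eventually_slope_bounds_above {f : ℝ → ℝ} {d v s : ℝ} (hf : HasDerivAt f d s)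
    (hv : d < v) :
    ∀ᶠ r in 𝓝 s, (s ≤ r → f r - f s ≤ v * (r - s)) ∧ (r ≤ s → v * (r - s) ≤ f r - f s) := by
  filter_upwards [eventually_slope_bounds hf.neg (neg_lt_neg hv)] with r hr
  simp only [Pi.neg_apply] at hr
  exact ⟨fun h => by linarith [hr.1 h], fun h => by linarith [hr.2 h]⟩

theorem hasSubslopeOn_of_lt_deriv {γ : ℝ → ℝ} {a b s d v : ℝ} (hγ : IsCharacteristicOn ω φ γ a b)
    (hs : s ∈ Ioo a b) (hd : HasDerivAt (fun r => φ (r, γ r)) d s) (hv : v < d) :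
    ∃ δ > 0, HasSubslopeOn ω φ v δ (s, γ s) := by
  obtain ⟨δ, hδ, hball⟩ := Metric.eventually_nhds_iff_ball.1
    ((eventually_slope_bounds hd hv).and (Ioo_mem_nhds hs.1 hs.2))
  rw [Real.ball_eq_Ioo] at hball
  exact ⟨δ, hδ, γ, rfl, fun r hr => hγ r (hball r hr).2, fun r hr => (hball r hr).1⟩

theorem le_of_hasSubslopeOn_of_hasDerivAt {v δ : ℝ} (hδ : 0 < δ) {f : ℝ → ℝ} {s d : ℝ}
    (hf : HasDerivAt f d s) (h : ∀ r ∈ Ioo (s - δ) (s + δ), s ≤ r → v * (r - s) ≤ f r - f s) :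
    v ≤ d := by
  by_contra! hlt
  obtain ⟨w, hw1, hw2⟩ := exists_between hlt
  obtain ⟨r, ⟨h1, h2⟩, h3⟩ := (((eventually_slope_bounds_above hf hw1).and
    (Ioo_mem_nhds (sub_lt_self s hδ) (lt_add_of_pos_right s hδ))).filter_mono
    nhdsWithin_le_nhds |>.and (self_mem_nhdsWithin (s := Ioi s))).exists
  have h3' : s < r := h3
  have := h r h2 h3'.le
  have := h1.1 h3'.le
  nlinarith

theorem LipschitzAlong.le_of_hasSubslopeOn (hC : LipschitzAlong ω φ C) {v δ : ℝ} (hδ : 0 < δ)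
    {A : ℝ × ℝ} (h : HasSubslopeOn ω φ v δ A) : v ≤ C := by
  obtain ⟨γ, h1, h2, h3⟩ := h
  have hm : A.1 + δ / 2 ∈ Ioo (A.1 - δ) (A.1 + δ) := by constructor <;> linarith
  have h4 := (h3 _ hm).1 (by linarith)
  have h5 := (abs_le.1 (hC γ _ _ h2 A.1 ⟨by linarith, by linarith⟩ _ hm)).2
  rw [h1, add_sub_cancel_left, abs_of_pos (half_pos hδ)] at h5
  rw [add_sub_cancel_left] at h4
  exact le_of_mul_le_mul_right (h4.trans h5) (half_pos hδ)

theorem LipschitzAlong.bddAbove (hC : LipschitzAlong ω φ C) (A : ℝ × ℝ) :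
    BddAbove {v | ∃ δ > 0, HasSubslopeOn ω φ v δ A} :=
  ⟨C, fun _ ⟨_, hδ, h⟩ => hC.le_of_hasSubslopeOn hδ h⟩

theorem LipschitzAlong.nonempty (hω : IsOpen ω) (hφ : ContinuousOn φ ω)
    (hC : LipschitzAlong ω φ C) {A : ℝ × ℝ} (hA : A ∈ ω) :
    {v | ∃ δ > 0, HasSubslopeOn ω φ v δ A}.Nonempty := by
  obtain ⟨δ, hδ, h⟩ := exists_uncrossed_characteristic hω hφ hA
  obtain ⟨γ, h1, h2, -⟩ := h.self_of_nhds
  refine ⟨-C, δ, hδ, γ, h1, h2, fun s hs => ?_⟩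
  have h3 := hC γ _ _ h2 A.1 ⟨by linarith, by linarith⟩ s hs
  rw [h1] at h3
  constructor
  · intro h
    rw [abs_of_nonneg (sub_nonneg.2 h), abs_le] at h3
    linarith [h3.1]
  · intro h
    rw [abs_of_nonpos (sub_nonpos.2 h), abs_le] at h3
    linarith [h3.2]

theorem lt_maxSlope_iff (hω : IsOpen ω) (hφ : ContinuousOn φ ω) (hC : LipschitzAlong ω φ C)
    {A : ℝ × ℝ} (hA : A ∈ ω) {q : ℝ} :
    q < maxSlope ω φ A ↔ ∃ v : ℚ, q < v ∧ ∃ δ > 0, HasSubslopeOn ω φ v δ A := by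
  constructor
  · intro h
    obtain ⟨v, ⟨δ, hδ, γ, h1, h2, h3⟩, hlt⟩ := exists_lt_of_lt_csSup (hC.nonempty hω hφ hA) h
    obtain ⟨w, hw1, hw2⟩ := exists_rat_btwn hlt
    refine ⟨w, hw1, δ, hδ, γ, h1, h2, fun s hs => ⟨fun h => ?_, fun h => ?_⟩⟩
    · nlinarith [(h3 s hs).1 h]
    · nlinarith [(h3 s hs).2 h]
  · rintro ⟨v, h1, h2⟩
    exact h1.trans_le (le_csSup (hC.bddAbove A) h2)

/-- If `φ` has the same derivative `α` at `A` along all characteristics, then `maxSlope` is `α`. -/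
theorem maxSlope_eq_of_hasIntrinsicDerivAt (hω : IsOpen ω) (hφ : ContinuousOn φ ω)
    (hC : LipschitzAlong ω φ C) {A : ℝ × ℝ} (hA : A ∈ ω) {α : ℝ}
    (h : HasIntrinsicDerivAt ω φ α A) : maxSlope ω φ A = α := by
  have key : ∀ (γ : ℝ → ℝ) (δ : ℝ), 0 < δ → γ A.1 = A.2 →
      IsCharacteristicOn ω φ γ (A.1 - δ) (A.1 + δ) →
      HasDerivAt (fun s => φ (s, γ s)) α A.1 := by
    intro γ δ hδ h1 h2
    have := h δ (fun s => (A.1 + s, γ (A.1 + s))) hδ (fun s hs => ?_) (by simp [h1])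
    · have h3 := (this.comp_of_eq A.1 ((hasDerivAt_id A.1).sub_const A.1) (by simp))
      simpa [Function.comp_def] using h3
    · obtain ⟨h3, h4⟩ := h2 (A.1 + s) ⟨by linarith [hs.1], by linarith [hs.2]⟩
      have h5 : HasDerivAt (fun s => A.1 + s) 1 s := (hasDerivAt_id s).const_add A.1
      refine ⟨h3, h5.prodMk ?_⟩
      have h6 : HasDerivAt (fun s => γ (A.1 + s)) (φ (A.1 + s, γ (A.1 + s)) * 1) s := h4.comp s h5
      rwa [mul_one] at h6
  refine le_antisymm (csSup_le (hC.nonempty hω hφ hA) ?_) (le_of_forall_lt fun v hv => ?_)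
  · rintro v ⟨δ, hδ, γ, h1, h2, h3⟩
    refine le_of_hasSubslopeOn_of_hasDerivAt hδ (key γ δ hδ h1 h2) fun r hr hle => ?_
    rw [h1]
    exact (h3 r hr).1 hle
  · obtain ⟨w, hw1, hw2⟩ := exists_between hv
    obtain ⟨δ, hδ, hex⟩ := exists_uncrossed_characteristic hω hφ hA
    obtain ⟨γ, h1, h2, -⟩ := hex.self_of_nhds
    have h3 := hasSubslopeOn_of_lt_deriv h2 ⟨by linarith, by linarith⟩ (key γ δ hδ h1 h2) hw2
    rw [h1] at h3
    exact hw1.trans_le (le_csSup (hC.bddAbove A) h3)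

/-! ### Borel measurability of the maximal slope -/

section Measurability

/-- A closed approximation of the set of points with subslope `v`, using curves inside `K`. -/
def subslopeSet (φ : ℝ × ℝ → ℝ) (C v δ : ℝ) (K : Set (ℝ × ℝ)) : Set (ℝ × ℝ) :=
  {A | ∃ u : ℝ → ℝ, u 0 = A.2 ∧ ∀ r ∈ Icc (-δ) δ, (A.1 + r, u r) ∈ K ∧
    (∀ s ∈ Icc (-δ) δ, |u s - u r - φ (A.1 + r, u r) * (s - r)| ≤ C * (s - r) ^ 2) ∧
    (0 ≤ r → v * r ≤ φ (A.1 + r, u r) - φ (A.1 + 0, u 0)) ∧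
    (r ≤ 0 → φ (A.1 + r, u r) - φ (A.1 + 0, u 0) ≤ v * r)}

/-- Every defining condition is a non-strict inequality or membership in a compact set. A pointwise
ultrafilter limit of the curves, as their base points converge, satisfies them again. -/
theorem isClosed_subslopeSet {K : Set (ℝ × ℝ)} (hK : IsCompact K) (hφ : ContinuousOn φ K)
    {v δ : ℝ} (hδ : 0 < δ) : IsClosed (subslopeSet φ C v δ K) := by
  refine IsSeqClosed.isClosed fun A A₀ hA hlim => ?_
  choose u hu0 hu using hA
  set U : Ultrafilter ℕ := hyperfilter ℕ
  have hlimU : Tendsto A U (𝓝 A₀) := hlim.mono_left Nat.hyperfilter_le_atTop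
  have hex : ∀ r ∈ Icc (-δ) δ, ∃ x, (A₀.1 + r, x) ∈ K ∧ Tendsto (fun n => u n r) U (𝓝 x) := by
    intro r hr
    obtain ⟨p, hpK, hp⟩ := hK.ultrafilter_le_nhds (U.map fun n => ((A n).1 + r, u n r)) (by
      rw [le_principal_iff]
      exact Filter.mem_map.2 (Filter.univ_mem' fun n => (hu n r hr).1))
    have hp' : Tendsto (fun n => ((A n).1 + r, u n r)) U (𝓝 p) := hp
    have h1 : p.1 = A₀.1 + r := tendsto_nhds_unique
      ((continuous_fst.tendsto p).comp hp')
      (((continuous_fst.tendsto A₀).comp hlimU).add_const r)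
    exact ⟨p.2, h1 ▸ hpK, (continuous_snd.tendsto p).comp hp'⟩
  choose! u₀ hu₀K hu₀ using hex
  have hφlim : ∀ r ∈ Icc (-δ) δ,
      Tendsto (fun n => φ ((A n).1 + r, u n r)) U (𝓝 (φ (A₀.1 + r, u₀ r))) := by
    intro r hr
    refine (hφ _ (hu₀K r hr)).tendsto.comp (tendsto_nhdsWithin_iff.2 ⟨?_,
      Eventually.of_forall fun n => (hu n r hr).1⟩)
    exact (((continuous_fst.tendsto A₀).comp hlimU).add_const r).prodMk_nhds (hu₀ r hr)
  have h0 : (0 : ℝ) ∈ Icc (-δ) δ := ⟨by linarith, hδ.le⟩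
  refine ⟨u₀, ?_, fun r hr => ⟨hu₀K r hr, fun s hs => ?_, fun h => ?_, fun h => ?_⟩⟩
  · refine tendsto_nhds_unique (hu₀ 0 h0) ?_
    simp only [hu0]
    exact (continuous_snd.tendsto A₀).comp hlimU
  · exact le_of_tendsto (((hu₀ s hs).sub (hu₀ r hr)).sub ((hφlim r hr).mul_const _)).abs
      (Eventually.of_forall fun n => (hu n r hr).2.1 s hs)
  · exact ge_of_tendsto ((hφlim r hr).sub (hφlim 0 h0))
      (Eventually.of_forall fun n => (hu n r hr).2.2.1 h)
  · exact le_of_tendsto ((hφlim r hr).sub (hφlim 0 h0))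
      (Eventually.of_forall fun n => (hu n r hr).2.2.2 h)

theorem hasSubslopeOn_of_mem_subslopeSet {K : Set (ℝ × ℝ)} (hK : K ⊆ ω) {v δ : ℝ}
    {A : ℝ × ℝ} (hA : A ∈ subslopeSet φ C v δ K) : HasSubslopeOn ω φ v δ A := by
  obtain ⟨u, hu0, hu⟩ := hA
  have hsh : ∀ s ∈ Ioo (A.1 - δ) (A.1 + δ), s - A.1 ∈ Ioo (-δ) δ := fun s hs =>
    ⟨by linarith [hs.1], by linarith [hs.2]⟩
  refine ⟨fun s => u (s - A.1), by simpa using hu0, fun s hs => ?_, fun s hs => ?_⟩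
  · obtain ⟨h1, h2, -⟩ := hu _ (Ioo_subset_Icc_self (hsh s hs))
    rw [add_sub_cancel] at h1 h2
    refine ⟨hK h1, hasDerivAt_of_quadratic (C := C) ?_⟩
    filter_upwards [Ioo_mem_nhds hs.1 hs.2] with x hx
    have := h2 _ (Ioo_subset_Icc_self (hsh x hx))
    rwa [sub_sub_sub_cancel_right] at this
  · obtain ⟨-, -, h1, h2⟩ := hu _ (Ioo_subset_Icc_self (hsh s hs))
    rw [add_sub_cancel, add_zero, hu0] at h1 h2
    exact ⟨fun h => h1 (by linarith), fun h => h2 (by linarith)⟩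

theorem HasSubslopeOn.eventually_mem_subslopeSet (hC : LipschitzAlong ω φ C) (hC0 : 0 ≤ C)
    {K : Set (ℝ × ℝ)} {v δ : ℝ} (hδ : 0 < δ) {A : ℝ × ℝ} (hK : K ∈ 𝓝 A)
    (hA : HasSubslopeOn ω φ v δ A) : ∀ᶠ ε in 𝓝 (0 : ℝ), A ∈ subslopeSet φ C v ε K := by
  obtain ⟨γ, h1, h2, h3⟩ := hA
  have hm : A.1 ∈ Ioo (A.1 - δ) (A.1 + δ) := ⟨by linarith, by linarith⟩
  have hc : ContinuousAt (fun s => (s, γ s)) A.1 := continuousAt_id.prodMk (h2.continuousAt hm)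
  have hA' : (fun s => (s, γ s)) A.1 = A := by simp [h1]
  obtain ⟨ε, hε, hball⟩ := Metric.eventually_nhds_iff_ball.1 (hc.eventually (hA'.symm ▸ hK))
  rw [Real.ball_eq_Ioo] at hball
  filter_upwards [gt_mem_nhds hε, gt_mem_nhds hδ] with e he heδ
  have hsh : ∀ r ∈ Icc (-e) e, A.1 + r ∈ Ioo (A.1 - δ) (A.1 + δ) ∧
      A.1 + r ∈ Ioo (A.1 - ε) (A.1 + ε) := fun r hr =>
    ⟨⟨by linarith [hr.1], by linarith [hr.2]⟩, ⟨by linarith [hr.1], by linarith [hr.2]⟩⟩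
  refine ⟨fun r => γ (A.1 + r), by simpa using h1, fun r hr => ⟨hball _ (hsh r hr).2,
    fun s hs => ?_, fun h => ?_, fun h => ?_⟩⟩
  · have := hC.quadratic hC0 h2 (hsh r hr).1 (hsh s hs).1
    rwa [add_sub_add_left_eq_sub] at this
  · have := (h3 _ (hsh r hr).1).1 (by linarith)
    simp only [add_zero, h1]
    linarith
  · have := (h3 _ (hsh r hr).1).2 (by linarith)
    simp only [add_zero, h1]
    linarith

theorem exists_compact_cover (hω : IsOpen ω) : ∃ K : ℕ → Set (ℝ × ℝ), (∀ n, IsCompact (K n)) ∧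
    (∀ n, K n ⊆ ω) ∧ ∀ A ∈ ω, ∃ n, K n ∈ 𝓝 A := by
  have : LocallyCompactSpace ω := hω.locallyCompactSpace
  let E : CompactExhaustion ω := default
  refine ⟨fun n => Subtype.val '' E n, fun n => (E.isCompact n).image continuous_subtype_val,
    fun n => by simp, fun A hA => ?_⟩
  obtain ⟨n, hn⟩ := E.exists_mem_nhds ⟨A, hA⟩
  exact ⟨n, hω.isOpenEmbedding_subtypeVal.isOpenMap.image_mem_nhds hn⟩

theorem measurableSet_hasSubslope (hω : IsOpen ω) (hφ : ContinuousOn φ ω)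
    (hC : LipschitzAlong ω φ C) (hC0 : 0 ≤ C) (v : ℝ) :
    MeasurableSet {A | ∃ δ > 0, HasSubslopeOn ω φ v δ A} := by
  obtain ⟨K, hKc, hKω, hK⟩ := exists_compact_cover hω
  have heq : {A | ∃ δ > 0, HasSubslopeOn ω φ v δ A} =
      ⋃ (m : ℕ) (n : ℕ), subslopeSet φ C v (1 / (n + 1)) (K m) := by
    ext A
    simp only [mem_ofPred_eq, mem_iUnion]
    constructor
    · rintro ⟨δ, hδ, h⟩
      obtain ⟨m, hm⟩ := hK A (h.mem hδ)
      obtain ⟨n, hn⟩ := (tendsto_one_div_add_atTop_nhds_zero_nat.eventually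
        (h.eventually_mem_subslopeSet hC hC0 hδ hm)).exists
      exact ⟨m, n, hn⟩
    · rintro ⟨m, n, h⟩
      exact ⟨_, by positivity, hasSubslopeOn_of_mem_subslopeSet (hKω m) h⟩
  rw [heq]
  exact .iUnion fun m => .iUnion fun n =>
    (isClosed_subslopeSet (hKc m) (hφ.mono (hKω m)) (by positivity)).measurableSet

theorem universallyMeasurableOn_maxSlope (hω : IsOpen ω) (hφ : ContinuousOn φ ω)
    (hC : LipschitzAlong ω φ C) (hC0 : 0 ≤ C) : UniversallyMeasurableOn ω (maxSlope ω φ) := by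
  intro B hB μ _
  have hm : Measurable (fun A : ω => maxSlope ω φ A) := by
    refine measurable_of_Ioi fun q => ?_
    have : (fun A : ω => maxSlope ω φ A) ⁻¹' Ioi q =
        ⋃ v : {v : ℚ // q < v}, Subtype.val ⁻¹' {A | ∃ δ > 0, HasSubslopeOn ω φ v δ A} := by
      ext A
      simp only [mem_preimage, mem_Ioi, mem_iUnion, lt_maxSlope_iff hω hφ hC A.2, mem_ofPred_eq,
        Subtype.exists, exists_prop]
    rw [this]
    exact .iUnion fun v => measurable_subtype_coe (measurableSet_hasSubslope hω hφ hC hC0 v)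
  have h2 := hω.measurableSet.subtype_image (hm hB)
  rw [show ω ∩ maxSlope ω φ ⁻¹' B = Subtype.val '' ((fun A : ω => maxSlope ω φ A) ⁻¹' B) by
    ext A; simp [and_comm]]
  exact h2.nullMeasurableSet

end Measurability

/-! ### The derivative along a characteristic is almost everywhere the maximal slope -/

section Broad

/-- Times at which, over radius `δ`, the slope of `φ` along `γ` is at most `q` while another
characteristic through the same point has slope at least `v`. -/
def gapTimes (ω : Set (ℝ × ℝ)) (φ : ℝ × ℝ → ℝ) (γ : ℝ → ℝ) (a b q v δ : ℝ) : Set ℝ :=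
  {s | s ∈ Ioo a b ∧ (∀ r ∈ Ioo a b, |r - s| < δ →
    (s ≤ r → φ (r, γ r) - φ (s, γ s) ≤ q * (r - s)) ∧
    (r ≤ s → q * (r - s) ≤ φ (r, γ r) - φ (s, γ s))) ∧ HasSubslopeOn ω φ v δ (s, γ s)}

/-- Suppose two such times were closer than `δ`. The steep curve from `s₀` runs above `γ` forwards,
and the steep curve from `s₁` runs above `γ` backwards, so the two meet in between. Following one up
to the meeting point and then the other, `φ` gains at least `v * (s₁ - s₀)`, whereas along `γ` it
gains at most `q * (s₁ - s₀)`. -/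
theorem le_abs_sub_of_mem_gapTimes {γ : ℝ → ℝ} {a b q v δ : ℝ}
    (hγ : IsCharacteristicOn ω φ γ a b) (hqv : q < v) {s₀ s₁ : ℝ}
    (h₀ : s₀ ∈ gapTimes ω φ γ a b q v δ) (h₁ : s₁ ∈ gapTimes ω φ γ a b q v δ) (hlt : s₀ < s₁) :
    δ ≤ s₁ - s₀ := by
  by_contra! hδ
  obtain ⟨hs₀, hq₀, η₀, e₀, c₀, b₀⟩ := h₀
  obtain ⟨hs₁, hq₁, η₁, e₁, c₁, b₁⟩ := h₁
  simp only at e₀ c₀ b₀ e₁ c₁ b₁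
  have hI : ∀ r ∈ Icc s₀ s₁, r ∈ Ioo a b ∧ r ∈ Ioo (s₀ - δ) (s₀ + δ) ∧
      r ∈ Ioo (s₁ - δ) (s₁ + δ) ∧ |r - s₀| < δ ∧ |r - s₁| < δ := by
    intro r hr
    rw [abs_lt, abs_lt]
    refine ⟨⟨hs₀.1.trans_le hr.1, hr.2.trans_lt hs₁.2⟩, ⟨?_, ?_⟩, ⟨?_, ?_⟩, ⟨?_, ?_⟩, ?_, ?_⟩ <;>
      linarith [hr.1, hr.2]
  have hl : s₀ ∈ Icc s₀ s₁ := left_mem_Icc.2 hlt.le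
  have hr : s₁ ∈ Icc s₀ s₁ := right_mem_Icc.2 hlt.le
  have hcγ : ∀ r ∈ Icc s₀ s₁, HasDerivAt γ (φ (r, γ r)) r := fun r hr => (hγ r (hI r hr).1).2
  have hc0 : ∀ r ∈ Icc s₀ s₁, HasDerivAt η₀ (φ (r, η₀ r)) r := fun r hr =>
    (c₀ r (hI r hr).2.1).2
  have hc1 : ∀ r ∈ Icc s₀ s₁, HasDerivAt η₁ (φ (r, η₁ r)) r := fun r hr =>
    (c₁ r (hI r hr).2.2.1).2
  have hg0 : γ s₁ ≤ η₀ s₁ := by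
    refine image_le_of_deriv_right_le_deriv_boundary
      (fun r hr => (hcγ r hr).continuousAt.continuousWithinAt)
      (fun r hr => (hcγ r (Ico_subset_Icc_self hr)).hasDerivWithinAt) e₀.ge
      (fun r hr => (hc0 r hr).continuousAt.continuousWithinAt)
      (fun r hr => (hc0 r (Ico_subset_Icc_self hr)).hasDerivWithinAt) (fun r hr => ?_) hr
    have hr' := Ico_subset_Icc_self hr
    have h1 := (hq₀ r (hI r hr').1 (hI r hr').2.2.2.1).1 hr.1
    have h2 := (b₀ r (hI r hr').2.1).1 hr.1
    nlinarith [hr.1]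
  have hg1 : γ s₀ ≤ η₁ s₀ := by
    have hanti : AntitoneOn (fun r => η₁ r - γ r) (Icc s₀ s₁) := by
      refine antitoneOn_of_hasDerivWithinAt_nonpos (convex_Icc _ _)
        (f' := fun r => φ (r, η₁ r) - φ (r, γ r))
        (fun r hr => ((hc1 r hr).sub (hcγ r hr)).continuousAt.continuousWithinAt)
        (fun r hr => ((hc1 r (interior_subset hr)).sub
          (hcγ r (interior_subset hr))).hasDerivWithinAt) (fun r hr => ?_)
      have hr' := interior_subset hr
      have h1 := (hq₁ r (hI r hr').1 (hI r hr').2.2.2.2).2 hr'.2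
      have h2 := (b₁ r (hI r hr').2.2.1).2 hr'.2
      nlinarith [hr'.2]
    have := hanti hl hr hlt.le
    simp only [e₁, sub_self] at this
    linarith
  obtain ⟨r, hrI, hr0⟩ : (0 : ℝ) ∈ (fun r => η₀ r - η₁ r) '' Icc s₀ s₁ := by
    refine intermediate_value_Icc hlt.le
      (fun r hr => ((hc0 r hr).sub (hc1 r hr)).continuousAt.continuousWithinAt) ⟨?_, ?_⟩
    · change η₀ s₀ - η₁ s₀ ≤ 0
      linarith
    · change 0 ≤ η₀ s₁ - η₁ s₁
      linarith
  have h1 := (b₀ r (hI r hrI).2.1).1 hrI.1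
  have h2 := (b₁ r (hI r hrI).2.2.1).2 hrI.2
  have h3 := (hq₀ s₁ hs₁ (hI s₁ hr).2.2.2.1).1 hlt.le
  rw [sub_eq_zero.1 hr0] at h1
  nlinarith

theorem countable_of_separated {S : Set ℝ} {δ : ℝ} (hδ : 0 < δ)
    (h : ∀ x ∈ S, ∀ y ∈ S, x < y → δ ≤ y - x) : S.Countable := by
  have hfl : ∀ x y : ℝ, ⌊x / δ⌋ = ⌊y / δ⌋ → y - x < δ := by
    intro x y hxy
    have := (abs_lt.1 (Int.abs_sub_lt_one_of_floor_eq_floor hxy.symm)).2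
    rwa [← sub_div, div_lt_one hδ] at this
  refine (mapsTo_univ (fun x : ℝ => ⌊x / δ⌋) S).countable_of_injOn (fun x hx y hy hxy => ?_)
    countable_univ
  rcases lt_trichotomy x y with hlt | rfl | hlt
  · exact absurd (h x hx y hy hlt) (not_le.2 (hfl x y hxy))
  · rfl
  · exact absurd (h y hy x hx hlt) (not_le.2 (hfl y x hxy.symm))

theorem LipschitzAlong.lipschitzOnWith (hC : LipschitzAlong ω φ C) (hC0 : 0 ≤ C) {γ : ℝ → ℝ}
    {a b : ℝ} (hγ : IsCharacteristicOn ω φ γ a b) :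
    LipschitzOnWith ⟨C, hC0⟩ (fun s => φ (s, γ s)) (Ioo a b) :=
  LipschitzOnWith.of_dist_le_mul fun x hx y hy =>
    hC γ a b hγ y hy x hx

/-- Along every characteristic, `φ` has derivative `maxSlope` almost everywhere. -/
theorem ae_hasDerivAt_maxSlope (hω : IsOpen ω) (hφ : ContinuousOn φ ω)
    (hC : LipschitzAlong ω φ C) (hC0 : 0 ≤ C) {γ : ℝ → ℝ} {a b : ℝ}
    (hγ : IsCharacteristicOn ω φ γ a b) :
    ∀ᵐ s ∂(volume.restrict (Ioo a b)),
      HasDerivAt (fun r => φ (r, γ r)) (maxSlope ω φ (s, γ s)) s := by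
  have hdiff := (hC.lipschitzOnWith hC0 hγ).ae_differentiableWithinAt_real measurableSet_Ioo
  set N : Set ℝ := ⋃ (q : ℚ) (v : {v : ℚ // q < v}) (n : ℕ),
    gapTimes ω φ γ a b q v (1 / (n + 1)) with hN
  have hNc : N.Countable := countable_iUnion fun q => countable_iUnion fun v =>
    countable_iUnion fun n => countable_of_separated (by positivity) fun x hx y hy hxy =>
      le_abs_sub_of_mem_gapTimes hγ (by exact_mod_cast v.2) hx hy hxy
  have hNae : ∀ᵐ s ∂(volume.restrict (Ioo a b)), s ∉ N :=
    ae_restrict_of_ae (measure_eq_zero_iff_ae_notMem.1 (hNc.measure_zero volume))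
  filter_upwards [hdiff, hNae, ae_restrict_mem measurableSet_Ioo] with s hs hsN hsI
  have hd := (hs.differentiableAt (Ioo_mem_nhds hsI.1 hsI.2)).hasDerivAt
  set d := deriv (fun r => φ (r, γ r)) s
  have hsω := (hγ s hsI).1
  suffices maxSlope ω φ (s, γ s) = d by rwa [this]
  refine le_antisymm ?_ (le_of_forall_lt fun v hv => ?_)
  · by_contra! hlt
    apply hsN
    -- Rational `q`, `v` and radii `1 / (n + 1)` place `s` in one of countably many sets of
    -- separated times.
    obtain ⟨q, hq1, hq2⟩ := exists_rat_btwn hlt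
    obtain ⟨v, hv1, δ, hδ, hv⟩ := (lt_maxSlope_iff hω hφ hC hsω).1 hq2
    obtain ⟨ε, hε, hball⟩ :=
      Metric.eventually_nhds_iff_ball.1 (eventually_slope_bounds_above hd hq1)
    obtain ⟨n, hn⟩ := exists_nat_one_div_lt (lt_min hε hδ)
    refine mem_iUnion.2 ⟨q, mem_iUnion.2 ⟨⟨v, by exact_mod_cast hv1⟩, mem_iUnion.2 ⟨n, hsI,
      fun r _ hr => hball r ?_, hv.anti (hn.le.trans (min_le_right _ _))⟩⟩⟩
    rw [mem_ball, Real.dist_eq]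
    exact hr.trans (hn.trans_le (min_le_left _ _))
  · obtain ⟨w, hw1, hw2⟩ := exists_between hv
    exact hw1.trans_le (le_csSup (hC.bddAbove _) (hasSubslopeOn_of_lt_deriv hγ hsI hd hw2))

end Broad

end BalanceLaw

/-! ### From Lipschitz bounds along characteristics to Lagrangian solutions -/

namespace BalanceLaw

open Filter Topology Metric

theorem absolutelyContinuousOn_of_dist_le {X : Type*} [PseudoMetricSpace X] {f : ℝ → X}
    {I : Set ℝ} {K : ℝ} (hK : 0 ≤ K) (h : ∀ x ∈ I, ∀ y ∈ I, dist (f y) (f x) ≤ K * |y - x|) :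
    AbsolutelyContinuousOn f I := by
  intro ε hε
  refine ⟨ε / (K + 1), by positivity, fun n a b hab _ hsum => ?_⟩
  have h0 : 0 ≤ ∑ i, (b i - a i) := Finset.sum_nonneg fun i _ => sub_nonneg.2 (hab i).1
  calc ∑ i, dist (f (b i)) (f (a i)) ≤ ∑ i, K * (b i - a i) := by
        refine Finset.sum_le_sum fun i _ => ?_
        have := h (a i) (hab i).2.1 (b i) (hab i).2.2
        rwa [abs_of_nonneg (sub_nonneg.2 (hab i).1)] at this
    _ = K * ∑ i, (b i - a i) := by rw [Finset.mul_sum]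
    _ ≤ (K + 1) * ∑ i, (b i - a i) := by nlinarith
    _ < ε := by rwa [mul_comm, ← lt_div_iff₀ (by linarith)]

variable {ω : Set (ℝ × ℝ)} {φ : ℝ × ℝ → ℝ} {C : ℝ}

theorem LipschitzAlong.exists_lipschitz (hC : LipschitzAlong ω φ C) (hC0 : 0 ≤ C) {γ : ℝ → ℝ}
    {a b : ℝ} (hγ : IsCharacteristicOn ω φ γ a b) :
    ∃ M, 0 ≤ M ∧ ∀ x ∈ Ioo a b, ∀ y ∈ Ioo a b, |γ y - γ x| ≤ M * |y - x| := by
  -- The speed of `γ` is `φ` along it, which is bounded by its value at the midpoint plus the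
  -- Lipschitz variation.
  refine ⟨|φ ((a + b) / 2, γ ((a + b) / 2))| + C * |b - a|, by positivity, fun x hx y hy => ?_⟩
  have hm : (a + b) / 2 ∈ Ioo a b := by constructor <;> linarith [hx.1, hx.2]
  refine (convex_Ioo a b).norm_image_sub_le_of_norm_hasDerivWithin_le
    (fun s hs => (hγ s hs).2.hasDerivWithinAt) (fun s hs => ?_) hx hy
  have h1 := hC γ a b hγ _ hm s hs
  have h2 : |s - (a + b) / 2| ≤ |b - a| := by
    rw [abs_of_pos (by linarith [hx.1, hx.2] : 0 < b - a), abs_le]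
    constructor <;> linarith [hs.1, hs.2, hx.1, hx.2]
  have h3 := abs_sub_abs_le_abs_sub (φ (s, γ s)) (φ ((a + b) / 2, γ ((a + b) / 2)))
  rw [Real.norm_eq_abs]
  linarith [mul_le_mul_of_nonneg_left h2 hC0]

theorem isCharacteristicOn_paramChi (hω : IsOpen ω) (hφ : ContinuousOn φ ω)
    (hC : LipschitzAlong ω φ C) (hC0 : 0 ≤ C) {τ s₁ s₂ : ℝ}
    (h : ∀ s ∈ Ioo s₁ s₂, (s, τ) ∈ paramDomain ω φ) :
    IsCharacteristicOn ω φ (fun s => paramChi ω φ (s, τ)) s₁ s₂ := fun s hs =>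
  ⟨paramChi_mem hω hφ (h s hs), hasDerivAt_paramChi hω hφ hC hC0 (h s hs)⟩

theorem isLagrangianParam_paramChi (hω : IsOpen ω) (hφ : ContinuousOn φ ω)
    (hC : LipschitzAlong ω φ C) (hC0 : 0 ≤ C) :
    IsLagrangianParam ω φ (paramDomain ω φ) (paramChi ω φ) where
  isOpen := isOpen_paramDomain hω
  borel := (continuousOn_paramChi hω hφ).domRestrict.measurable
  mapsTo := fun _ hp => paramChi_mem hω hφ hp
  monotone := monotoneOn_paramChi hω hφ
  surjOn := surjOn_paramChi hω hφ
  absCont := by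
    intro τ s₁ s₂ h
    obtain ⟨M, hM0, hM⟩ :=
      hC.exists_lipschitz hC0 (isCharacteristicOn_paramChi hω hφ hC hC0 h)
    refine absolutelyContinuousOn_of_dist_le (K := 1 + M) (by linarith) fun x hx y hy => ?_
    rw [Prod.dist_eq]
    have h1 := hM x hx y hy
    have h2 := abs_nonneg (y - x)
    refine max_le ?_ ?_
    · change |y - x| ≤ _
      nlinarith
    · refine le_trans h1 ?_
      nlinarith
  characteristic := by
    intro τ s₁ s₂ h
    filter_upwards [ae_restrict_mem measurableSet_Ioo] with s hs
    exact hasDerivAt_paramChi hω hφ hC hC0 (h s hs)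

/-- A continuous function that is Lipschitz along all characteristics is a Lagrangian solution. -/
theorem LipschitzAlong.isLagrangianSolution (hω : IsOpen ω) (hφ : ContinuousOn φ ω)
    (hC : LipschitzAlong ω φ C) (hC0 : 0 ≤ C) : IsLagrangianSolution ω φ := by
  refine ⟨maxSlope ω φ, hφ, universallyMeasurableOn_maxSlope hω hφ hC hC0,
    ⟨paramDomain ω φ, paramChi ω φ, isLagrangianParam_paramChi hω hφ hC hC0,
      fun τ s₁ s₂ h => ?_⟩, fun A hA α => maxSlope_eq_of_hasIntrinsicDerivAt hω hφ hC hA⟩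
  have hchar := isCharacteristicOn_paramChi hω hφ hC hC0 h
  exact ⟨absolutelyContinuousOn_of_dist_le hC0 fun x hx y hy => hC _ _ _ hchar x hx y hy,
    ae_hasDerivAt_maxSlope hω hφ hC hC0 hchar⟩

/-! ### Intrinsic Lipschitz functions are Lipschitz along characteristics -/

section IntrinsicLipschitz

theorem mul_sqrt_mul_le {L x y : ℝ} (hx : 0 ≤ x) (hy : 0 ≤ y) :
    L * Real.sqrt (x * y) ≤ x / 2 + L ^ 2 * y / 2 := by
  rw [Real.sqrt_mul hx]
  have h1 := Real.sq_sqrt hx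
  have h2 := Real.sq_sqrt hy
  nlinarith [sq_nonneg (Real.sqrt x - L * Real.sqrt y)]

theorem sqrt_add_le_add_sqrt {x y : ℝ} (hx : 0 ≤ x) (hy : 0 ≤ y) :
    Real.sqrt (x + y) ≤ Real.sqrt x + Real.sqrt y := by
  rw [Real.sqrt_le_left (by positivity)]
  nlinarith [Real.sq_sqrt hx, Real.sq_sqrt hy, Real.sqrt_nonneg x, Real.sqrt_nonneg y]

/-- Replacing the mean of `φ A` and `φ B` by `φ A` in `graphDist` costs at most the square root of
`|φ A - φ B| * |B.1 - A.1|`. By Young's inequality half of `|φ A - φ B|` is absorbed on the left. -/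
theorem IsIntrinsicLipschitz.continuousOn (h : IsIntrinsicLipschitz ω φ) :
    ContinuousOn φ ω := by
  obtain ⟨L, hL, h⟩ := h
  intro A hA
  rw [ContinuousWithinAt, tendsto_iff_dist_tendsto_zero]
  set F : ℝ × ℝ → ℝ := fun B => 2 * L * (|B.1 - A.1| +
    Real.sqrt |B.2 - A.2 - φ A * (B.1 - A.1)|) + L ^ 2 * |B.1 - A.1| with hF
  have hFc : Tendsto F (𝓝[ω] A) (𝓝 0) := by
    have : Continuous F := by fun_prop
    have h0 := this.tendsto A
    simp only [hF, sub_self, abs_zero, mul_zero, Real.sqrt_zero, add_zero] at h0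
    exact h0.mono_left nhdsWithin_le_nhds
  refine squeeze_zero' (Eventually.of_forall fun _ => dist_nonneg)
    (eventually_nhdsWithin_of_forall fun B hB => ?_) hFc
  have h1 := h A hA B hB
  set x := |φ A - φ B| with hx
  have hsqrt : Real.sqrt |B.2 - A.2 - 1 / 2 * (φ A + φ B) * (B.1 - A.1)| ≤
      Real.sqrt |B.2 - A.2 - φ A * (B.1 - A.1)| + Real.sqrt (x * |B.1 - A.1|) := by
    refine (Real.sqrt_le_sqrt ?_).trans (sqrt_add_le_add_sqrt (abs_nonneg _) (by positivity))
    have : B.2 - A.2 - 1 / 2 * (φ A + φ B) * (B.1 - A.1) =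
      (B.2 - A.2 - φ A * (B.1 - A.1)) + 1 / 2 * ((φ A - φ B) * (B.1 - A.1)) := by ring
    rw [this]
    refine (abs_add_le _ _).trans (add_le_add_right ?_ _)
    rw [abs_mul, abs_mul, abs_of_pos (by norm_num : (0 : ℝ) < 1 / 2), ← hx]
    have : 0 ≤ x * |B.1 - A.1| := by positivity
    linarith
  have h2 := mul_sqrt_mul_le (L := L) (abs_nonneg (φ A - φ B)) (abs_nonneg (B.1 - A.1))
  rw [← hx] at h2
  rw [Real.dist_eq, abs_sub_comm, ← hx, hF]
  simp only [graphDist] at h1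
  nlinarith

theorem IsIntrinsicLipschitz.exists_lipschitzAlong (h : IsIntrinsicLipschitz ω φ) :
    ∃ C, 0 ≤ C ∧ LipschitzAlong ω φ C := by
  have hφ := h.continuousOn
  obtain ⟨L, hL, h⟩ := h
  refine ⟨2 * L + L ^ 2, by positivity, fun γ a b hγ x hx y hy => ?_⟩
  have hsub : uIcc x y ⊆ Ioo a b := ordConnected_Ioo.uIcc_subset hx hy
  set f : ℝ → ℝ := fun s => φ (s, γ s) with hf
  have hfc : ContinuousOn f (uIcc x y) := by
    refine hφ.comp (fun s hs => ?_) fun s hs => (hγ s (hsub hs)).1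
    exact (continuousAt_id.prodMk (hγ.continuousAt (hsub hs))).continuousWithinAt
  have hfc2 : ContinuousOn (fun p : ℝ × ℝ => |f p.2 - f p.1|) (uIcc x y ×ˢ uIcc x y) :=
    ((hfc.comp continuousOn_snd fun p hp => hp.2).sub
      (hfc.comp continuousOn_fst fun p hp => hp.1)).abs
  -- At a pair of maximal oscillation `m`, the speed of `γ` differs from the mean of `f p` and `f q`
  -- by at most `m`. This gives `m ≤ L * (H + √(m * H))`, and absorbing `m / 2` yields the constant
  -- `2 * L + L ^ 2`.
  obtain ⟨⟨p, q⟩, ⟨hp, hq⟩, hmax⟩ := (isCompact_uIcc.prod isCompact_uIcc).exists_isMaxOn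
    ⟨(x, y), left_mem_uIcc, right_mem_uIcc⟩ hfc2
  simp only at hp hq
  have hm : ∀ r ∈ uIcc x y, ∀ s ∈ uIcc x y, |f s - f r| ≤ |f q - f p| := fun r hr s hs =>
    hmax (show (r, s) ∈ uIcc x y ×ˢ uIcc x y from ⟨hr, hs⟩)
  set m := |f q - f p| with hmdef
  set H := |y - x| with hH
  have hqp : |q - p| ≤ H :=
    abs_sub_le_of_uIcc_subset_uIcc (uIcc_subset_uIcc hp hq)
  have hm0 : 0 ≤ m := abs_nonneg _
  have hH0 : 0 ≤ H := abs_nonneg _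
  have hsub' : uIcc p q ⊆ uIcc x y := uIcc_subset_uIcc hp hq
  have key : |γ q - γ p - 1 / 2 * (f p + f q) * (q - p)| ≤ m * H := by
    have := (convex_uIcc p q).norm_image_sub_le_of_norm_hasDerivWithin_le
      (f := fun s => γ s - s * (1 / 2 * (f p + f q))) (C := m)
      (f' := fun s => f s - 1 * (1 / 2 * (f p + f q)))
      (fun s hs => ((hγ s (hsub (hsub' hs))).2.hasDerivWithinAt).sub
        ((hasDerivWithinAt_id s _).mul_const _)) (fun s hs => ?_) left_mem_uIcc right_mem_uIcc
    · rw [Real.norm_eq_abs, Real.norm_eq_abs] at this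
      calc _ = |γ q - q * (1 / 2 * (f p + f q)) - (γ p - p * (1 / 2 * (f p + f q)))| := by ring_nf
        _ ≤ _ := this
        _ ≤ _ := mul_le_mul_of_nonneg_left hqp hm0
    · have h1 := abs_le.1 (hm p hp s (hsub' hs))
      have h2 := abs_le.1 (hm q hq s (hsub' hs))
      rw [Real.norm_eq_abs, abs_le]
      constructor <;> linarith
  have h1 := h (p, γ p) (hγ p (hsub hp)).1 (q, γ q) (hγ q (hsub hq)).1
  rw [abs_sub_comm] at h1
  have h2 : graphDist φ (p, γ p) (q, γ q) ≤ H + Real.sqrt (m * H) :=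
    add_le_add hqp (Real.sqrt_le_sqrt key)
  have h3 := mul_sqrt_mul_le (L := L) hm0 hH0
  have h4 : m ≤ L * (H + Real.sqrt (m * H)) := h1.trans (mul_le_mul_of_nonneg_left h2 hL.le)
  have h5 := hm x left_mem_uIcc y right_mem_uIcc
  change |f y - f x| ≤ _
  nlinarith

end IntrinsicLipschitz

end BalanceLaw

/-! ### The balance law integrated over a strip along a curve -/

namespace BalanceLaw

open Filter Topology Metric

theorem fderiv_apply_one_right {Φ : ℝ × ℝ → ℝ} (p : ℝ × ℝ) (c : ℝ) :
    fderiv ℝ Φ p (1, c) = fderiv ℝ Φ p (1, 0) + c * fderiv ℝ Φ p (0, 1) := by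
  rw [show ((1, c) : ℝ × ℝ) = (1, 0) + c • (0, 1) by ext <;> simp, map_add, map_smul, smul_eq_mul]

/-- Integral of `∂_z Φ + ∂_t G` over the strip of width `ε` along one side of a `C¹` curve, in
terms of the boundary values. -/
theorem integral_strip_sub_le {Φ G : ℝ × ℝ → ℝ} (hΦ : ContDiff ℝ 1 Φ) (hG : ContDiff ℝ 1 G)
    {γ c : ℝ → ℝ} (hc : Continuous c) (hγ : ∀ s, HasDerivAt γ (c s) s) {x y ε C κ σ : ℝ}
    (hxy : x ≤ y) (hε : 0 ≤ ε) (hσ : |σ| = 1)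
    (hC : ∀ s ∈ Icc x y, ∀ u ∈ Icc 0 ε, |fderiv ℝ Φ (s, γ s + σ * u) (1, 0) +
      fderiv ℝ G (s, γ s + σ * u) (0, 1)| ≤ C)
    (hκ : ∀ s ∈ Icc x y, c s * (Φ (s, γ s + σ * ε) - Φ (s, γ s)) -
      (G (s, γ s + σ * ε) - G (s, γ s)) ≤ κ) :
    (∫ u in (0 : ℝ)..ε, σ * Φ (y, γ y + σ * u)) - (∫ u in (0 : ℝ)..ε, σ * Φ (x, γ x + σ * u)) ≤
      (C * ε + κ) * (y - x) := by
  have hγc : Continuous γ := continuous_iff_continuousAt.2 fun s => (hγ s).continuousAt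
  have hΦd := hΦ.continuous_fderiv one_ne_zero
  have hGd := hG.continuous_fderiv one_ne_zero
  have hΦc := hΦ.continuous
  set H : ℝ → ℝ → ℝ := fun u s => σ * fderiv ℝ Φ (s, γ s + σ * u) (1, c s) with hH
  have hHc : Continuous (Function.uncurry H) := by
    simp only [hH, Function.uncurry_def]
    fun_prop
  have hcurve : ∀ u s, HasDerivAt (fun s => σ * Φ (s, γ s + σ * u)) (H u s) s := by
    intro u s
    have h1 := ((hΦ.differentiable one_ne_zero (s, γ s + σ * u)).hasFDerivAt).comp_hasDerivAt s
      ((hasDerivAt_id s).prodMk ((hγ s).add_const (σ * u)))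
    exact h1.const_mul σ
  have hftc : ∀ u, σ * Φ (y, γ y + σ * u) - σ * Φ (x, γ x + σ * u) = ∫ s in x..y, H u s := by
    intro u
    rw [intervalIntegral.integral_eq_sub_of_hasDerivAt (fun s _ => hcurve u s)]
    exact Continuous.intervalIntegrable (hHc.comp (Continuous.prodMk_right u)) _ _
  have hvert : ∀ (F : ℝ × ℝ → ℝ), ContDiff ℝ 1 F → ∀ s,
      ∫ u in (0 : ℝ)..ε, σ * fderiv ℝ F (s, γ s + σ * u) (0, 1) =
        F (s, γ s + σ * ε) - F (s, γ s) := by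
    intro F hF s
    have hFd := hF.continuous_fderiv one_ne_zero
    rw [intervalIntegral.integral_eq_sub_of_hasDerivAt
      (f := fun u => F (s, γ s + σ * u)) (fun u _ => ?_)]
    · simp
    · exact Continuous.intervalIntegrable (by fun_prop) _ _
    · have h1 := ((hF.differentiable one_ne_zero (s, γ s + σ * u)).hasFDerivAt).comp_hasDerivAt u
        ((hasDerivAt_const u s).prodMk (((hasDerivAt_id u).const_mul σ).const_add (γ s)))
      rw [show ((0, σ * 1) : ℝ × ℝ) = σ • (0, 1) by ext <;> simp, map_smul] at h1
      exact h1
  have hinner : ∀ s ∈ Icc x y, ∫ u in (0 : ℝ)..ε, H u s ≤ C * ε + κ := by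
    intro s hs
    -- The derivative along the curve is the balance-law expression plus `∂_t (c Φ - G)`. As `c s`
    -- does not depend on `u`, the latter integrates exactly to the boundary flux in `hκ`.
    have hsplit : ∀ u, H u s = σ * (fderiv ℝ Φ (s, γ s + σ * u) (1, 0) +
        fderiv ℝ G (s, γ s + σ * u) (0, 1)) +
        (c s * (σ * fderiv ℝ Φ (s, γ s + σ * u) (0, 1)) -
          σ * fderiv ℝ G (s, γ s + σ * u) (0, 1)) := by
      intro u
      simp only [hH]
      rw [fderiv_apply_one_right]
      ring
    simp only [hsplit]
    rw [intervalIntegral.integral_add, intervalIntegral.integral_sub,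
      intervalIntegral.integral_const_mul (c s), hvert Φ hΦ, hvert G hG]
    · refine add_le_add ?_ (hκ s hs)
      have := intervalIntegral.norm_integral_le_of_norm_le_const (a := 0) (b := ε) (C := C)
        (f := fun u => σ * (fderiv ℝ Φ (s, γ s + σ * u) (1, 0) +
          fderiv ℝ G (s, γ s + σ * u) (0, 1))) (fun u hu => ?_)
      · rw [sub_zero, abs_of_nonneg hε] at this
        exact (le_abs_self _).trans this
      · rw [uIoc_of_le hε] at hu
        rw [Real.norm_eq_abs, abs_mul, hσ, one_mul]
        exact hC s hs u (Ioc_subset_Icc_self hu)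
    all_goals exact Continuous.intervalIntegrable (by fun_prop) _ _
  rw [← intervalIntegral.integral_sub]
  · simp only [hftc]
    rw [intervalIntegral_intervalIntegral_swap]
    · calc ∫ s in x..y, ∫ u in (0 : ℝ)..ε, H u s ≤ ∫ _ in x..y, (C * ε + κ) := by
            refine intervalIntegral.integral_mono_on hxy ?_ (by simp) hinner
            refine Continuous.intervalIntegrable ?_ _ _
            exact intervalIntegral.continuous_parametric_intervalIntegral_of_continuous'
              (f := fun s u => H u s) (hHc.comp continuous_swap) _ _
        _ = _ := by rw [intervalIntegral.integral_const, smul_eq_mul, mul_comm]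
    · exact (hHc.continuousOn.integrableOn_compact (isCompact_uIcc.prod isCompact_uIcc)).mono_set
        (prod_mono uIoc_subset_uIcc uIoc_subset_uIcc)
  all_goals exact Continuous.intervalIntegrable (by fun_prop) _ _

end BalanceLaw

/-! ### Mollification of distributional solutions -/

namespace BalanceLaw

open Filter Topology Metric
open scoped Convolution

variable {ω : Set (ℝ × ℝ)} {φ w : ℝ × ℝ → ℝ} {C : ℝ}

/-- The derivative of a mollification as an integral against the derivative of the kernel. -/
theorem fderiv_normed_convolution_apply (ρ : ContDiffBump (0 : ℝ × ℝ)) {g : ℝ × ℝ → ℝ}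
    (hg : Integrable g) (p v : ℝ × ℝ) :
    Integrable (fun q => fderiv ℝ (ρ.normed volume) (p - q) v * g q) ∧
    fderiv ℝ (ρ.normed volume ⋆[ContinuousLinearMap.lsmul ℝ ℝ, volume] g) p v =
      ∫ q, fderiv ℝ (ρ.normed volume) (p - q) v * g q := by
  have hρc : HasCompactSupport (ρ.normed volume) := ρ.hasCompactSupport_normed
  have hρ1 : ContDiff ℝ 1 (ρ.normed (volume : Measure (ℝ × ℝ))) := ρ.contDiff_normed (n := 1)
  have hρd := hρ1.continuous_fderiv one_ne_zero
  have hint : Integrable (fun q => ((ContinuousLinearMap.lsmul ℝ ℝ).precompL (ℝ × ℝ)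
      (fderiv ℝ (ρ.normed volume) (p - q))) (g q)) := by
    have h1 := (hρc.fderiv ℝ).convolutionExists_left (μ := volume)
      ((ContinuousLinearMap.lsmul ℝ ℝ).precompL (ℝ × ℝ)) hρd hg.locallyIntegrable p
    exact h1.integrable_swap
  refine ⟨hint.apply_continuousLinearMap v, ?_⟩
  rw [(hρc.hasFDerivAt_convolution_left _ hρ1 hg.locallyIntegrable p).fderiv,
    convolution_eq_swap, ContinuousLinearMap.integral_apply hint]
  rfl

/-- The expression is the weak formulation tested with the translated reflected kernel, so it is an
average of `w` against a probability density supported in `ω`. -/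
theorem IsDistributionalSolution.abs_mollified_le (hω : IsOpen ω)
    (hsol : IsDistributionalSolution ω φ w) (hw : ∀ᵐ p ∂(volume.restrict ω), |w p| ≤ C)
    {K : Set (ℝ × ℝ)} (hK : IsCompact K) (hKω : K ⊆ ω) (ρ : ContDiffBump (0 : ℝ × ℝ))
    {p : ℝ × ℝ} (hp : closedBall p ρ.rOut ⊆ K) :
    |fderiv ℝ (ρ.normed volume ⋆[ContinuousLinearMap.lsmul ℝ ℝ, volume] K.indicator φ) p (1, 0) +
      fderiv ℝ (ρ.normed volume ⋆[ContinuousLinearMap.lsmul ℝ ℝ, volume]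
        K.indicator (fun q => 1 / 2 * φ q ^ 2)) p (0, 1)| ≤ C := by
  have hφK := hsol.continuousOn.mono hKω
  have hi1 : Integrable (K.indicator φ) :=
    (hφK.integrableOn_compact hK).integrable_indicator hK.measurableSet
  have hi2 : Integrable (K.indicator fun q => 1 / 2 * φ q ^ 2) :=
    ((continuousOn_const.mul (hφK.pow 2)).integrableOn_compact hK).integrable_indicator
      hK.measurableSet
  obtain ⟨j1, e1⟩ := fderiv_normed_convolution_apply ρ hi1 p (1, 0)
  obtain ⟨j2, e2⟩ := fderiv_normed_convolution_apply ρ hi2 p (0, 1)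
  set f : ℝ × ℝ → ℝ := fun q => ρ.normed volume (p - q) with hf
  have hρs : ContDiff ℝ (⊤ : ℕ∞) (ρ.normed (volume : Measure (ℝ × ℝ))) := ρ.contDiff_normed
  have hfs : ContDiff ℝ (⊤ : ℕ∞) f := hρs.comp (contDiff_const.sub contDiff_id)
  have hzero : ∀ q ∉ closedBall p ρ.rOut,
      p - q ∉ tsupport (ρ.normed (volume : Measure (ℝ × ℝ))) := by
    intro q hq h
    rw [ρ.tsupport_normed_eq, mem_closedBall, dist_zero_right] at h
    exact hq (by rwa [mem_closedBall, dist_comm, dist_eq_norm])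
  have hft : tsupport f ⊆ closedBall p ρ.rOut := by
    refine closure_minimal (fun q hq => ?_) isClosed_closedBall
    by_contra h
    exact hq (image_eq_zero_of_notMem_tsupport (f := ρ.normed volume) (hzero q h))
  have hfc : HasCompactSupport f :=
    (isCompact_closedBall p ρ.rOut).of_isClosed_subset (isClosed_tsupport f) hft
  have hfd : ∀ q v, fderiv ℝ f q v = -fderiv ℝ (ρ.normed volume) (p - q) v := by
    intro q v
    have h1 := ((hρs.differentiable (by simp) (p - q)).hasFDerivAt).comp q
      ((hasFDerivAt_id q).const_sub p)
    have h2 : HasFDerivAt f _ q := h1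
    rw [h2.fderiv]
    simp
  have hweak := hsol.integral_eq f hfs hfc (hft.trans (hp.trans hKω))
  have hsum : ∫ q, (fderiv ℝ (ρ.normed volume) (p - q) (1, 0) * K.indicator φ q +
      fderiv ℝ (ρ.normed volume) (p - q) (0, 1) * K.indicator (fun q => 1 / 2 * φ q ^ 2) q) =
      ∫ q in ω, w q * f q := by
    -- Reflecting the kernel flips the sign of its derivative, which cancels the minus sign of the
    -- weak formulation.
    rw [← neg_inj, ← hweak, ← integral_neg, ← integral_indicator hω.measurableSet]
    refine integral_congr_ae (Eventually.of_forall fun q => ?_)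
    by_cases hq : q ∈ closedBall p ρ.rOut
    · have h1 := hp hq
      simp only [indicator_of_mem h1, indicator_of_mem (hKω h1), hfd]
      ring
    · have h0 : fderiv ℝ (ρ.normed volume) (p - q) = 0 :=
        image_eq_zero_of_notMem_tsupport (f := fderiv ℝ (ρ.normed volume)) fun h =>
          hzero q hq (tsupport_fderiv_subset ℝ h)
      have h2 : ω.indicator (fun q => φ q * fderiv ℝ f q (1, 0) +
          1 / 2 * φ q ^ 2 * fderiv ℝ f q (0, 1)) q = 0 := by
        refine indicator_apply_eq_zero.2 fun _ => ?_
        simp [hfd, h0]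
      simp only [h2, h0]
      simp
  rw [e1, e2, ← integral_add j1 j2, hsum]
  have hfi : Integrable f := hfs.continuous.integrable_of_hasCompactSupport hfc
  have hf0 : ∀ q, 0 ≤ f q := fun q => ρ.nonneg_normed _
  have hf1 : ∫ q, f q = 1 := by
    rw [hf, integral_sub_left_eq_self (fun q => ρ.normed volume q) volume p]
    exact ρ.integral_normed
  have hC0 : ∀ᵐ q ∂(volume.restrict ω), ‖w q * f q‖ ≤ C * f q := by
    filter_upwards [hw] with q hq
    rw [norm_mul, Real.norm_eq_abs, Real.norm_eq_abs, abs_of_nonneg (hf0 q)]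
    exact mul_le_mul_of_nonneg_right hq (hf0 q)
  have hsupp : ∫ q in ω, f q = ∫ q, f q :=
    setIntegral_eq_integral_of_forall_compl_eq_zero fun q hq => by
      by_contra h
      exact hq (hKω (hp (hft (subset_tsupport f h))))
  calc |∫ q in ω, w q * f q| ≤ ∫ q in ω, C * f q :=
        norm_integral_le_of_norm_le (hfi.const_mul C).integrableOn hC0
    _ = C := by rw [integral_const_mul, hsupp, hf1, mul_one]

/-- Smooth approximations, uniform on a compact set, of a continuous distributional solution. -/
theorem IsDistributionalSolution.exists_smooth_approx (hω : IsOpen ω)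
    (hsol : IsDistributionalSolution ω φ w) (hw : ∀ᵐ p ∂(volume.restrict ω), |w p| ≤ C)
    {S : Set (ℝ × ℝ)} (hS : IsCompact S) {r : ℝ} (hr : 0 < r) (hSω : cthickening r S ⊆ ω)
    {η : ℝ} (hη : 0 < η) :
    ∃ Φ G : ℝ × ℝ → ℝ, ContDiff ℝ 1 Φ ∧ ContDiff ℝ 1 G ∧ ∀ p ∈ S,
      |Φ p - φ p| ≤ η ∧ |G p - 1 / 2 * φ p ^ 2| ≤ η ∧
      |fderiv ℝ Φ p (1, 0) + fderiv ℝ G p (0, 1)| ≤ C := by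
  set K := cthickening r S
  have hK : IsCompact K := hS.cthickening
  have hφK := hsol.continuousOn.mono hSω
  have hφK2 : ContinuousOn (fun q => 1 / 2 * φ q ^ 2) K := continuousOn_const.mul (hφK.pow 2)
  obtain ⟨d₁, hd₁, h₁⟩ := Metric.uniformContinuousOn_iff.1
    (hK.uniformContinuousOn_of_continuous hφK) η hη
  obtain ⟨d₂, hd₂, h₂⟩ := Metric.uniformContinuousOn_iff.1
    (hK.uniformContinuousOn_of_continuous hφK2) η hη
  set d := min r (min d₁ d₂)
  have hd : 0 < d := lt_min hr (lt_min hd₁ hd₂)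
  let ρ : ContDiffBump (0 : ℝ × ℝ) := ⟨d / 2, d, half_pos hd, half_lt_self hd⟩
  have hi1 : Integrable (K.indicator φ) :=
    (hφK.integrableOn_compact hK).integrable_indicator hK.measurableSet
  have hi2 : Integrable (K.indicator fun q => 1 / 2 * φ q ^ 2) :=
    (hφK2.integrableOn_compact hK).integrable_indicator hK.measurableSet
  have hρ1 : ContDiff ℝ 1 (ρ.normed (volume : Measure (ℝ × ℝ))) := ρ.contDiff_normed (n := 1)
  refine ⟨ρ.normed volume ⋆[ContinuousLinearMap.lsmul ℝ ℝ, volume] K.indicator φ,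
    ρ.normed volume ⋆[ContinuousLinearMap.lsmul ℝ ℝ, volume]
      K.indicator (fun q => 1 / 2 * φ q ^ 2),
    ρ.hasCompactSupport_normed.contDiff_convolution_left _ hρ1 hi1.locallyIntegrable,
    ρ.hasCompactSupport_normed.contDiff_convolution_left _ hρ1 hi2.locallyIntegrable,
    fun p hp => ?_⟩
  have hball : closedBall p ρ.rOut ⊆ K :=
    (closedBall_subset_closedBall (min_le_left _ _)).trans
      (closedBall_subset_cthickening hp r)
  have hpK : p ∈ K := self_subset_cthickening S hp
  have happ : ∀ (g : ℝ × ℝ → ℝ), Integrable (K.indicator g) →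
      (∀ x ∈ K, dist x p < d → dist (g x) (g p) < η) →
      |(ρ.normed volume ⋆[ContinuousLinearMap.lsmul ℝ ℝ, volume] K.indicator g) p - g p| ≤ η := by
    intro g hg h
    have := ρ.dist_normed_convolution_le (μ := volume) (x₀ := p) (ε := η)
      hg.aestronglyMeasurable (fun x hx => ?_)
    · rwa [indicator_of_mem hpK, Real.dist_eq] at this
    · have hxK := hball (ball_subset_closedBall hx)
      rw [indicator_of_mem hpK, indicator_of_mem hxK]
      exact (h x hxK hx).le
  refine ⟨happ φ hi1 fun x hx hxd => h₁ x hx p hpK (hxd.trans_le ?_),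
    happ _ hi2 fun x hx hxd => h₂ x hx p hpK (hxd.trans_le ?_),
    hsol.abs_mollified_le hω hw hK hSω ρ hball⟩
  · exact (min_le_right _ _).trans (min_le_left _ _)
  · exact (min_le_right _ _).trans (min_le_right _ _)

end BalanceLaw

/-! ### Distributional solutions are Lipschitz along characteristics -/

namespace BalanceLaw

open Filter Topology Metric

variable {ω : Set (ℝ × ℝ)} {φ w : ℝ × ℝ → ℝ} {C : ℝ}

/-- A characteristic agrees on a compact interval with a globally `C¹` curve. -/
theorem IsCharacteristicOn.exists_extension (hφ : ContinuousOn φ ω) {γ : ℝ → ℝ} {a b x y : ℝ}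
    (hγ : IsCharacteristicOn ω φ γ a b) (hx : x ∈ Ioo a b) (hy : y ∈ Ioo a b) (hxy : x ≤ y) :
    ∃ g c : ℝ → ℝ, Continuous c ∧ (∀ s, HasDerivAt g (c s) s) ∧
      ∀ s ∈ Icc x y, g s = γ s ∧ c s = φ (s, γ s) := by
  have hsub : Icc x y ⊆ Ioo a b := fun s hs => ⟨hx.1.trans_le hs.1, hs.2.trans_lt hy.2⟩
  have hcont : ContinuousOn (fun s => φ (s, γ s)) (Icc x y) :=
    hφ.comp (fun s hs => (continuousAt_id.prodMk
      (hγ.continuousAt (hsub hs))).continuousWithinAt) fun s hs => (hγ s (hsub hs)).1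
  set c : ℝ → ℝ := IccExtend hxy ((Icc x y).domRestrict fun s => φ (s, γ s)) with hc
  have hcc : Continuous c := hcont.domRestrict.Icc_extend'
  have hceq : ∀ s ∈ Icc x y, c s = φ (s, γ s) := fun s hs => by
    rw [hc, IccExtend_of_mem hxy _ hs]; rfl
  refine ⟨fun s => γ x + ∫ u in x..s, c u, c, hcc, fun s => ?_, fun s hs => ⟨?_, hceq s hs⟩⟩
  · exact (hcc.integral_hasStrictDerivAt x s).hasDerivAt.const_add _
  · have hsub' : uIcc x s ⊆ Icc x y := by
      rw [uIcc_of_le hs.1]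
      exact Icc_subset_Icc_right hs.2
    change γ x + ∫ u in x..s, c u = γ s
    rw [intervalIntegral.integral_eq_sub_of_hasDerivAt (f := γ) (fun u hu => ?_)
      (hcc.intervalIntegrable _ _)]
    · ring
    · rw [hceq u (hsub' hu)]
      exact (hγ u (hsub (hsub' hu))).2

/-- For `σ = 1` the strip lies above the curve and bounds the increase of `φ`; for `σ = -1` it lies
below and bounds the decrease. Dividing by the width and letting it shrink turns the strip averages
into values on the curve. -/
theorem IsDistributionalSolution.mul_sub_le (hω : IsOpen ω)
    (hsol : IsDistributionalSolution ω φ w) (hw : ∀ᵐ p ∂(volume.restrict ω), |w p| ≤ C)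
    {γ : ℝ → ℝ} {a b x y σ : ℝ} (hγ : IsCharacteristicOn ω φ γ a b) (hx : x ∈ Ioo a b)
    (hy : y ∈ Ioo a b) (hxy : x ≤ y) (hσ : |σ| = 1) :
    σ * (φ (y, γ y) - φ (x, γ x)) ≤ C * (y - x) := by
  obtain ⟨g, c, hc, hg, hgc⟩ := hγ.exists_extension hsol.continuousOn hx hy hxy
  have hgcont : Continuous g := continuous_iff_continuousAt.2 fun s => (hg s).continuousAt
  have hgω : ∀ s ∈ Icc x y, (s, g s) ∈ ω := fun s hs => by
    rw [(hgc s hs).1]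
    exact (hγ s ⟨hx.1.trans_le hs.1, hs.2.trans_lt hy.2⟩).1
  have hcφ : ∀ s ∈ Icc x y, c s = φ (s, g s) := fun s hs => by
    rw [(hgc s hs).1, (hgc s hs).2]
  have hxI : x ∈ Icc x y := left_mem_Icc.2 hxy
  have hyI : y ∈ Icc x y := right_mem_Icc.2 hxy
  rw [← (hgc x hxI).1, ← (hgc y hyI).1]
  obtain ⟨M, hM⟩ := isCompact_Icc.exists_bound_of_continuousOn (s := Icc x y) hc.continuousOn
  have hM0 : 0 ≤ M := (norm_nonneg _).trans (hM x hxI)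
  set S₀ := (fun s => (s, g s)) '' Icc x y with hS₀
  have hS₀c : IsCompact S₀ := isCompact_Icc.image (by fun_prop)
  obtain ⟨r, hr, hrω⟩ := hS₀c.exists_cthickening_subset_open hω (by
    rintro _ ⟨s, hs, rfl⟩
    exact hgω s hs)
  -- Half of the margin `r` is spent on the strip width, the other half on the mollification radius.
  set S := (fun p : ℝ × ℝ => (p.1, g p.1 + σ * p.2)) '' (Icc x y ×ˢ Icc 0 (r / 2)) with hS
  have hSc : IsCompact S := (isCompact_Icc.prod isCompact_Icc).image (by fun_prop)
  have hSS₀ : S ⊆ cthickening (r / 2) S₀ := by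
    rintro _ ⟨⟨s, u⟩, ⟨hs, hu⟩, rfl⟩
    refine mem_cthickening_of_dist_le _ (s, g s) _ _ ⟨s, hs, rfl⟩ ?_
    rw [Prod.dist_eq, dist_self, Real.dist_eq, add_sub_cancel_left, abs_mul, hσ, one_mul,
      abs_of_nonneg hu.1]
    exact max_le (by positivity) hu.2
  have hSω : cthickening (r / 2) S ⊆ ω := by
    refine (cthickening_subset_of_subset _ hSS₀).trans
      ((cthickening_cthickening_subset (by positivity) (by positivity) _).trans ?_)
    rwa [add_halves]
  refine le_of_forall_pos_le_add fun e he => ?_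
  -- The error consists of five portions: two from the oscillation of `φ` across the strip, two from
  -- `η ≤ θ` at its ends, and one from the flux term `η * B`.
  set θ := e / 5 with hθ
  have hθ0 : 0 < θ := by positivity
  have hnear : ∀ s ∈ Icc x y, ∀ᶠ u in 𝓝 (0 : ℝ), |φ (s, g s + σ * u) - φ (s, g s)| < θ := by
    intro s hs
    have h1 : ContinuousAt (fun u : ℝ => (s, g s + σ * u)) 0 := by fun_prop
    have h2 : ContinuousAt φ ((fun u : ℝ => (s, g s + σ * u)) 0) :=
      hsol.continuousOn.continuousAt (by simpa using hω.mem_nhds (hgω s hs))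
    have h3 : ContinuousAt (fun u : ℝ => |φ (s, g s + σ * u) - φ (s, g s)|) 0 :=
      ((h2.comp (f := fun u : ℝ => (s, g s + σ * u)) h1).sub continuousAt_const).abs
    exact h3.eventually (gt_mem_nhds (by simpa using hθ0))
  obtain ⟨ε₀, hε₀, hball⟩ :=
    Metric.eventually_nhds_iff_ball.1 ((hnear x hxI).and (hnear y hyI))
  set ε := min (ε₀ / 2) (r / 2) with hε
  have hε0 : 0 < ε := lt_min (by positivity) (by positivity)
  have hεr : ε ≤ r / 2 := min_le_right _ _
  have hnear' : ∀ u ∈ Icc 0 ε, |φ (x, g x + σ * u) - φ (x, g x)| < θ ∧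
      |φ (y, g y + σ * u) - φ (y, g y)| < θ := by
    intro u hu
    refine hball u ?_
    rw [mem_ball, Real.dist_eq, sub_zero, abs_of_nonneg hu.1]
    have : ε ≤ ε₀ / 2 := min_le_left _ _
    linarith [hu.2]
  set B := 2 * (1 + M) * (y - x) with hB
  have hB0 : 0 ≤ B := by
    have : 0 ≤ y - x := sub_nonneg.2 hxy
    positivity
  set η := min θ (θ * ε / (B + 1)) with hη
  have hη0 : 0 < η := lt_min hθ0 (by positivity)
  have hηθ : η ≤ θ := min_le_left _ _
  have hηB : η * B ≤ θ * ε := by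
    have h1 : η * (B + 1) ≤ θ * ε := (le_div_iff₀ (by positivity)).1 (min_le_right _ _)
    nlinarith
  obtain ⟨Φ, G, hΦ, hG, happ⟩ :=
    hsol.exists_smooth_approx hω hw hSc (half_pos hr) hSω hη0
  have hmem : ∀ s ∈ Icc x y, ∀ u ∈ Icc 0 ε, (s, g s + σ * u) ∈ S := fun s hs u hu =>
    ⟨(s, u), ⟨hs, hu.1, hu.2.trans hεr⟩, rfl⟩
  have key := integral_strip_sub_le (C := C) (κ := 2 * (1 + M) * η) hΦ hG hc hg hxy hε0.le hσ
    (fun s hs u hu => (happ _ (hmem s hs u hu)).2.2) (fun s hs => ?_)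
  · have hΦc := hΦ.continuous
    have hσ2 : ∀ z, |z| ≤ θ + η → -(θ + η) ≤ σ * z ∧ σ * z ≤ θ + η := by
      intro z hz
      rw [← abs_le, abs_mul, hσ, one_mul]
      exact hz
    have hlow : ε * (σ * φ (y, g y) - (θ + η)) ≤ ∫ u in (0 : ℝ)..ε, σ * Φ (y, g y + σ * u) := by
      have := intervalIntegral.integral_mono_on (μ := volume)
        (f := fun _ => σ * φ (y, g y) - (θ + η))
        (g := fun u => σ * Φ (y, g y + σ * u)) hε0.le (continuous_const.intervalIntegrable _ _)
        (Continuous.intervalIntegrable (by fun_prop) _ _) (fun u hu => ?_)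
      · simpa only [intervalIntegral.integral_const, sub_zero, smul_eq_mul] using this
      · have h1 := (happ _ (hmem y hyI u hu)).1
        have h2 := (hnear' u hu).2
        have h3 : |Φ (y, g y + σ * u) - φ (y, g y)| ≤ θ + η := by
          rw [abs_le] at h1 ⊢
          rw [abs_lt] at h2
          constructor <;> linarith
        linarith [(hσ2 _ h3).1]
    have hupp : ∫ u in (0 : ℝ)..ε, σ * Φ (x, g x + σ * u) ≤ ε * (σ * φ (x, g x) + (θ + η)) := by
      have := intervalIntegral.integral_mono_on (μ := volume)
        (g := fun _ => σ * φ (x, g x) + (θ + η))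
        (f := fun u => σ * Φ (x, g x + σ * u)) hε0.le
        (Continuous.intervalIntegrable (by fun_prop) _ _) intervalIntegrable_const (fun u hu => ?_)
      · simpa only [intervalIntegral.integral_const, sub_zero, smul_eq_mul] using this
      · have h1 := (happ _ (hmem x hxI u hu)).1
        have h2 := (hnear' u hu).1
        have h3 : |Φ (x, g x + σ * u) - φ (x, g x)| ≤ θ + η := by
          rw [abs_le] at h1 ⊢
          rw [abs_lt] at h2
          constructor <;> linarith
        linarith [(hσ2 _ h3).2]
    refine le_of_mul_le_mul_left ?_ hε0
    have h1 : ε * (2 * η) ≤ ε * (2 * θ) := by gcongr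
    calc ε * (σ * (φ (y, g y) - φ (x, g x)))
        = ε * (σ * φ (y, g y) - (θ + η)) - ε * (σ * φ (x, g x) + (θ + η)) +
          ε * (2 * θ) + ε * (2 * η) := by ring
      _ ≤ (C * ε + 2 * (1 + M) * η) * (y - x) + ε * (2 * θ) + ε * (2 * θ) := by linarith
      _ = ε * (C * (y - x)) + η * B + ε * (4 * θ) := by rw [hB]; ring
      _ ≤ ε * (C * (y - x)) + θ * ε + ε * (4 * θ) := by linarith
      _ = ε * (C * (y - x) + e) := by rw [hθ]; ring
  · have h1 := happ _ (hmem s hs ε ⟨hε0.le, le_rfl⟩)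
    have h0 := happ _ (hmem s hs 0 ⟨le_rfl, hε0.le⟩)
    rw [mul_zero, add_zero] at h0
    have hcM : |c s| ≤ M := hM s hs
    rw [← hcφ s hs] at h0
    set β := φ (s, g s + σ * ε)
    have h2 : c s * (Φ (s, g s + σ * ε) - β) ≤ M * η := by
      refine (le_abs_self _).trans ?_
      rw [abs_mul]
      exact mul_le_mul hcM h1.1 (abs_nonneg _) hM0
    have h3 : -(c s * (Φ (s, g s) - c s)) ≤ M * η := by
      refine (neg_le_abs _).trans ?_
      rw [abs_mul]
      exact mul_le_mul hcM h0.1 (abs_nonneg _) hM0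
    have h4 := abs_le.1 h1.2.1
    have h5 := abs_le.1 h0.2.1
    -- Without approximation the flux is `c (β - c) - (β² - c²) / 2 = -(β - c)² / 2 ≤ 0`. The errors
    -- in `Φ` cost `2 * M * η` and those in `G` cost `2 * η`.
    nlinarith [sq_nonneg (β - c s)]

theorem IsDistributionalSolution.exists_lipschitzAlong (hω : IsOpen ω)
    (hw : MemLp w ⊤ (volume.restrict ω)) (hsol : IsDistributionalSolution ω φ w) :
    ∃ C, 0 ≤ C ∧ LipschitzAlong ω φ C := by
  set C := (eLpNormEssSup w (volume.restrict ω)).toReal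
  have hfin : eLpNormEssSup w (volume.restrict ω) ≠ ⊤ := by
    simpa using hw.eLpNorm_ne_top
  have hwC : ∀ᵐ p ∂(volume.restrict ω), |w p| ≤ C := by
    filter_upwards [enorm_ae_le_eLpNormEssSup w (volume.restrict ω)] with p hp
    have := ENNReal.toReal_mono hfin hp
    rwa [toReal_enorm] at this
  have hle : ∀ (γ : ℝ → ℝ) (a b : ℝ), IsCharacteristicOn ω φ γ a b → ∀ x ∈ Ioo a b,
      ∀ y ∈ Ioo a b, x ≤ y → |φ (y, γ y) - φ (x, γ x)| ≤ C * (y - x) := by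
    intro γ a b hγ x hx y hy hxy
    have h1 := hsol.mul_sub_le hω hwC hγ hx hy hxy (σ := 1) (by simp)
    have h2 := hsol.mul_sub_le hω hwC hγ hx hy hxy (σ := -1) (by simp)
    rw [abs_le]
    constructor <;> linarith
  refine ⟨C, ENNReal.toReal_nonneg, fun γ a b hγ x hx y hy => ?_⟩
  rcases le_total x y with h | h
  · rw [abs_of_nonneg (sub_nonneg.2 h)]
    exact hle γ a b hγ x hx y hy h
  · rw [abs_sub_comm, abs_sub_comm y x, abs_of_nonneg (sub_nonneg.2 h)]
    exact hle γ a b hγ y hy x hx h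

end BalanceLaw

theorem corollary5p2 (ω : Set (ℝ × ℝ)) (hω : IsOpen ω) (φ : ℝ × ℝ → ℝ)
    (h : BalanceLaw.IsIntrinsicLipschitz ω φ ∨
      ∃ w : ℝ × ℝ → ℝ, MemLp w ⊤ (volume.restrict ω) ∧
        BalanceLaw.IsDistributionalSolution ω φ w) :
    BalanceLaw.IsLagrangianSolution ω φ := by
  rcases h with h | ⟨w, hw, hsol⟩
  · obtain ⟨C, hC0, hC⟩ := h.exists_lipschitzAlong
    exact hC.isLagrangianSolution hω h.continuousOn hC0
  · obtain ⟨C, hC0, hC⟩ := hsol.exists_lipschitzAlong hω hw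
    exact hC.isLagrangianSolution hω hsol.continuousOn hC0
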